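/- Let $m\ge 0$ and $\Lambda\ge 0$, and let $\Omega_\Lambda=(-\infty,-\Lambda)\cup(\Lambda,\infty)$. Let $AC^1(\overline{\Omega_\Lambda})$ be the space of all $f\in L^2(\Omega_\Lambda)$ that have a representative which is absolutely continuous on each of the closed half-lines $(-\infty,-\Lambda]$ and $[\Lambda,\infty)$, with $f'\in L^2(\Omega_\Lambda)$. The boundary values $f(-\Lambda)$ and $f(+\Lambda)$ are taken from the left and the right half-line respectively (so for $\Lambda=0$ they are the one-sided values $f(0^-)$ and $f(0^+)$). Let $AC^1_0(\overline{\Omega_\Lambda})$ be the subspace given by $f(-\Lambda)=f(+\Lambda)=0$. On $\mathbb{C}^2\otimes L^2(\Omega_\Lambda)\cong L^2(\Omega_\Lambda)\oplus L^2(\Omega_\Lambda)$ write $\psi={}^t(\psi_\uparrow,\psi_\downarrow)$. The minimal Dirac operator is $$H_0=\sigma_x\otimes\Big(-i\frac{d}{dx}\Big)+m\,\sigma_z\otimes I,\qquad D(H_0)=\mathbb{C}^2\otimes AC^1_0(\overline{\Omega_\Lambda}),$$ that is, $H_0\psi={}^t(-i\psi_\downarrow'+m\psi_\uparrow,\,-i\psi_\uparrow'-m\psi_\downarrow)$;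 let $H_0^*$ be its adjoint. For $\rho=(\rho_+,\rho_-)\in(\mathbb{R}\cup\{+\infty\})^2$ let $H_\rho$ be the restriction of $H_0^*$ to the set of all $\psi\in D(H_0^*)$ satisfying, for each of the two signs, $$i\rho_\pm\psi_\uparrow(\pm\Lambda)=\psi_\downarrow(\pm\Lambda)\ \text{ if }\rho_\pm\in\mathbb{R},\qquad \psi_\uparrow(\pm\Lambda)=0\ \text{ if }\rho_\pm=+\infty .\tag{BC-rho}$$ For $\alpha=(\alpha_1,\alpha_2,\alpha_3,\alpha_4)\in\mathbb{C}^4$ in the class $$\Re(\alpha_1\alpha_2^*)=\Re(\alpha_1\alpha_3^*)=\Re(\alpha_2\alpha_4^*)=\Re(\alpha_3\alpha_4^*)=0,\qquad \alpha_1\alpha_4^*+\alpha_2\alpha_3^*=\alpha_1\alpha_4^*+\alpha_2^*\alpha_3=1,\tag{Cl-alpha}$$ let $H_\alpha$ be the restriction of $H_0^*$ to the set of all $\psi\in D(H_0^*)$ satisfying $$\psi(+\Lambda)=B_\alpha\psi(-\Lambda),\qquad B_\alpha=\begin{pmatrix}\alpha_1&\alpha_2\\ \alpha_3&\alpha_4\end{pmatrix}.\tag{BC-alpha}$$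 Then an operator $H$ in $\mathbb{C}^2\otimes L^2(\Omega_\Lambda)$ is a self-adjoint extension of $H_0$ if and only if $H=H_\rho$ for some $\rho\in(\mathbb{R}\cup\{+\infty\})^2$ or $H=H_\alpha$ for some $\alpha$ in the class (Cl-alpha), and no operator $H$ is of both kinds. -/

import Mathlib

open MeasureTheory Set

noncomputable section

namespace DiracJunction

/-- The left island `(-∞, -Λ)`. -/
def leftIsland (Λ : ℝ) : Set ℝ := Iio (-Λ)

/-- The right island `(Λ, ∞)`. -/
def rightIsland (Λ : ℝ) : Set ℝ := Ioi Λ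

/-- The configuration space `Ω_Λ = (-∞, -Λ) ∪ (Λ, ∞)`. -/
def Omega (Λ : ℝ) : Set ℝ := leftIsland Λ ∪ rightIsland Λ

/-- The space `L²(Ω_Λ)` of complex-valued functions, for Lebesgue measure. -/
abbrev L2 (Λ : ℝ) : Type := Lp ℂ 2 (volume.restrict (Omega Λ))

/-- The Hilbert space `ℂ² ⊗ L²(Ω_Λ) ≅ L²(Ω_Λ) ⊕ L²(Ω_Λ)`; the first component `ψ.fst` is the
up-spin part and the second component `ψ.snd` is the down-spin part. -/
abbrev Spinor (Λ : ℝ) : Type := WithLp 2 (L2 Λ × L2 Λ)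

/-- For an open interval `I`: `f` belongs to `L²(I)`, is absolutely continuous on the closure of
`I` (that is, on each compact interval with end points in the closure of `I`; together with
`f' ∈ L²(I)` this gives absolute continuity on the whole closure), and `f' ∈ L²(I)`.
Only the values of `f` on the closure of `I` matter. -/
structure IsAC1On (I : Set ℝ) (f : ℝ → ℂ) : Prop where
  memLp : MemLp f 2 (volume.restrict I)
  ac : ∀ a ∈ closure I, ∀ b ∈ closure I, AbsolutelyContinuousOnInterval f a b
  memLp_deriv : MemLp (deriv f) 2 (volume.restrict I)

/-- The pair `(f, g)` represents the class `ψ ∈ L²(Ω_Λ)`: `f` is an `AC¹` representative of `ψ` on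
the closed left island `(-∞, -Λ]` and `g` is one on the closed right island `[Λ, ∞)`. The boundary
values of `ψ` at `-Λ` and at `+Λ` are then `f (-Λ)` and `g Λ`, also when `Λ = 0`. -/
structure IsACRep (Λ : ℝ) (ψ : L2 Λ) (f g : ℝ → ℂ) : Prop where
  left : IsAC1On (leftIsland Λ) f
  right : IsAC1On (rightIsland Λ) g
  ae_left : ψ =ᵐ[volume.restrict (leftIsland Λ)] f
  ae_right : ψ =ᵐ[volume.restrict (rightIsland Λ)] g

theorem isOpen_leftIsland (Λ : ℝ) : IsOpen (leftIsland Λ) := isOpen_Iio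

theorem isOpen_rightIsland (Λ : ℝ) : IsOpen (rightIsland Λ) := isOpen_Ioi

theorem IsAC1On.ae_differentiableAt {I : Set ℝ} (hI : IsOpen I) {f : ℝ → ℂ} (hf : IsAC1On I f) :
    ∀ᵐ x ∂(volume.restrict I), DifferentiableAt ℝ f x := by
  have h : ∀ᵐ x : ℝ, ∀ p q : ℚ, (p : ℝ) ∈ I → (q : ℝ) ∈ I → x ∈ uIcc (p : ℝ) q →
      DifferentiableAt ℝ f x := by
    rw [ae_all_iff]; intro p
    rw [ae_all_iff]; intro q
    by_cases hp : (p : ℝ) ∈ I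
    · by_cases hq : (q : ℝ) ∈ I
      · filter_upwards [(hf.ac p (subset_closure hp) q
          (subset_closure hq)).boundedVariationOn.ae_differentiableAt_of_mem_uIcc] with x hx _ _ hx'
        exact hx hx'
      · simp [hq]
    · simp [hp]
  rw [ae_restrict_iff' hI.measurableSet]
  filter_upwards [h] with x hx hxI
  obtain ⟨a, b, hab, hsub⟩ := mem_nhds_iff_exists_Ioo_subset.1 (hI.mem_nhds hxI)
  obtain ⟨p, hp⟩ := exists_rat_btwn hab.1
  obtain ⟨q, hq⟩ := exists_rat_btwn hab.2
  refine hx p q (hsub ⟨hp.1, hp.2.trans hab.2⟩) (hsub ⟨hab.1.trans hq.1, hq.2⟩) ?_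
  exact mem_uIcc.2 (Or.inl ⟨hp.2.le, hq.1.le⟩)

theorem IsAC1On.continuousOn {I : Set ℝ} (hI : IsOpen I) {f : ℝ → ℂ} (hf : IsAC1On I f) :
    ContinuousOn f I := by
  intro x hxI
  obtain ⟨a, b, hab, hsub⟩ := mem_nhds_iff_exists_Ioo_subset.1 (hI.mem_nhds hxI)
  obtain ⟨p, hp⟩ := exists_between hab.1
  obtain ⟨q, hq⟩ := exists_between hab.2
  have h := (hf.ac p (subset_closure (hsub ⟨hp.1, hp.2.trans hab.2⟩)) q
    (subset_closure (hsub ⟨hab.1.trans hq.1, hq.2⟩))).continuousOn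
  rw [uIcc_of_le (hp.2.trans hq.1).le] at h
  exact (h.continuousAt (Icc_mem_nhds hp.2 hq.1)).continuousWithinAt

theorem IsAC1On.deriv_add {I : Set ℝ} (hI : IsOpen I) {f g : ℝ → ℂ} (hf : IsAC1On I f)
    (hg : IsAC1On I g) : deriv (f + g) =ᵐ[volume.restrict I] deriv f + deriv g := by
  filter_upwards [hf.ae_differentiableAt hI, hg.ae_differentiableAt hI] with x h1 h2
  exact _root_.deriv_add h1 h2

theorem IsAC1On.add {I : Set ℝ} (hI : IsOpen I) {f g : ℝ → ℂ} (hf : IsAC1On I f)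
    (hg : IsAC1On I g) : IsAC1On I (f + g) :=
  ⟨hf.memLp.add hg.memLp, fun a ha b hb => (hf.ac a ha b hb).add (hg.ac a ha b hb),
    (hf.memLp_deriv.add hg.memLp_deriv).ae_eq (hf.deriv_add hI hg).symm⟩

theorem deriv_smul_fun (c : ℂ) (f : ℝ → ℂ) : deriv (c • f) = c • deriv f := by
  funext x
  change deriv (fun y => c * f y) x = c * deriv f x
  exact deriv_const_mul_field c

theorem IsAC1On.smul {I : Set ℝ} (c : ℂ) {f : ℝ → ℂ} (hf : IsAC1On I f) : IsAC1On I (c • f) :=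
  ⟨hf.memLp.const_smul c, fun a ha b hb => (hf.ac a ha b hb).const_smul c, by
    rw [deriv_smul_fun]; exact hf.memLp_deriv.const_smul c⟩

theorem isAC1On_zero (I : Set ℝ) : IsAC1On I (0 : ℝ → ℂ) :=
  ⟨MemLp.zero, fun a _ b _ =>
    (contDiff_zero_fun (𝕜 := ℝ) (n := 1)).contDiffOn.absolutelyContinuousOnInterval, by
      have : deriv (0 : ℝ → ℂ) = 0 := by funext x; simp
      rw [this]; exact MemLp.zero⟩

theorem ae_left_of_ae {Λ : ℝ} {p : ℝ → Prop} (h : ∀ᵐ x ∂(volume.restrict (Omega Λ)), p x) :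
    ∀ᵐ x ∂(volume.restrict (leftIsland Λ)), p x :=
  ae_mono (Measure.restrict_mono subset_union_left le_rfl) h

theorem ae_right_of_ae {Λ : ℝ} {p : ℝ → Prop} (h : ∀ᵐ x ∂(volume.restrict (Omega Λ)), p x) :
    ∀ᵐ x ∂(volume.restrict (rightIsland Λ)), p x :=
  ae_mono (Measure.restrict_mono subset_union_right le_rfl) h

theorem IsACRep.add {Λ : ℝ} {ψ φ : L2 Λ} {f g f' g' : ℝ → ℂ} (h : IsACRep Λ ψ f g)
    (h' : IsACRep Λ φ f' g') : IsACRep Λ (ψ + φ) (f + f') (g + g') where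
  left := h.left.add (isOpen_leftIsland Λ) h'.left
  right := h.right.add (isOpen_rightIsland Λ) h'.right
  ae_left := by
    filter_upwards [ae_left_of_ae (Lp.coeFn_add ψ φ), h.ae_left, h'.ae_left] with x h1 h2 h3
    rw [h1, Pi.add_apply, Pi.add_apply, h2, h3]
  ae_right := by
    filter_upwards [ae_right_of_ae (Lp.coeFn_add ψ φ), h.ae_right, h'.ae_right] with x h1 h2 h3
    rw [h1, Pi.add_apply, Pi.add_apply, h2, h3]

theorem IsACRep.smul {Λ : ℝ} (c : ℂ) {ψ : L2 Λ} {f g : ℝ → ℂ} (h : IsACRep Λ ψ f g) :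
    IsACRep Λ (c • ψ) (c • f) (c • g) where
  left := h.left.smul c
  right := h.right.smul c
  ae_left := by
    filter_upwards [ae_left_of_ae (Lp.coeFn_smul c ψ), h.ae_left] with x h1 h2
    rw [h1, Pi.smul_apply, Pi.smul_apply, h2]
  ae_right := by
    filter_upwards [ae_right_of_ae (Lp.coeFn_smul c ψ), h.ae_right] with x h1 h2
    rw [h1, Pi.smul_apply, Pi.smul_apply, h2]

theorem isACRep_zero (Λ : ℝ) : IsACRep Λ 0 0 0 where
  left := isAC1On_zero _
  right := isAC1On_zero _
  ae_left := ae_left_of_ae (Lp.coeFn_zero _ _ _)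
  ae_right := ae_right_of_ae (Lp.coeFn_zero _ _ _)

/-- Two representing pairs of the same class agree on the islands. -/
theorem IsACRep.unique {Λ : ℝ} {ψ : L2 Λ} {f g f' g' : ℝ → ℂ} (h : IsACRep Λ ψ f g)
    (h' : IsACRep Λ ψ f' g') : EqOn f f' (leftIsland Λ) ∧ EqOn g g' (rightIsland Λ) :=
  ⟨Measure.eqOn_open_of_ae_eq (h.ae_left.symm.trans h'.ae_left) (isOpen_leftIsland Λ)
      (h.left.continuousOn (isOpen_leftIsland Λ)) (h'.left.continuousOn (isOpen_leftIsland Λ)),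
    Measure.eqOn_open_of_ae_eq (h.ae_right.symm.trans h'.ae_right) (isOpen_rightIsland Λ)
      (h.right.continuousOn (isOpen_rightIsland Λ)) (h'.right.continuousOn (isOpen_rightIsland Λ))⟩

/-- The space `AC¹` of the closed islands, as a subspace of `L²(Ω_Λ)`. -/
def AC1 (Λ : ℝ) : Submodule ℂ (L2 Λ) where
  carrier := {ψ | ∃ f g, IsACRep Λ ψ f g}
  add_mem' := by
    rintro ψ φ ⟨f, g, h⟩ ⟨f', g', h'⟩
    exact ⟨_, _, h.add h'⟩
  zero_mem' := ⟨_, _, isACRep_zero Λ⟩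
  smul_mem' := by
    rintro c ψ ⟨f, g, h⟩
    exact ⟨_, _, h.smul c⟩

/-- The space `AC₀¹` of those elements of `AC¹` that vanish at the boundary points `-Λ`, `+Λ`. -/
def AC10 (Λ : ℝ) : Submodule ℂ (L2 Λ) where
  carrier := {ψ | ∃ f g, IsACRep Λ ψ f g ∧ f (-Λ) = 0 ∧ g Λ = 0}
  add_mem' := by
    rintro ψ φ ⟨f, g, h, h1, h2⟩ ⟨f', g', h', h1', h2'⟩
    exact ⟨_, _, h.add h', by simp [h1, h1'], by simp [h2, h2']⟩
  zero_mem' := ⟨_, _, isACRep_zero Λ, rfl, rfl⟩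
  smul_mem' := by
    rintro c ψ ⟨f, g, h, h1, h2⟩
    exact ⟨_, _, h.smul c, by simp [h1], by simp [h2]⟩

theorem AC10_le_AC1 (Λ : ℝ) : AC10 Λ ≤ AC1 Λ := by
  rintro ψ ⟨f, g, h, -, -⟩
  exact ⟨f, g, h⟩

open Classical in
/-- The derivative on `Ω_Λ` of the function given by `f` on the left and `g` on the right island. -/
def glueDeriv (Λ : ℝ) (f g : ℝ → ℂ) : ℝ → ℂ :=
  (leftIsland Λ).piecewise (deriv f) (deriv g)

theorem IsACRep.memLp_glueDeriv {Λ : ℝ} {ψ : L2 Λ} {f g : ℝ → ℂ} (h : IsACRep Λ ψ f g) :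
    MemLp (glueDeriv Λ f g) 2 (volume.restrict (Omega Λ)) := by
  classical
  refine MemLp.piecewise (isOpen_leftIsland Λ).measurableSet ?_ ?_
  · exact h.left.memLp_deriv.mono_measure
      (Measure.restrict_mono_measure Measure.restrict_le_self _)
  · refine h.right.memLp_deriv.mono_measure ?_
    rw [Measure.restrict_restrict (isOpen_leftIsland Λ).measurableSet.compl]
    refine Measure.restrict_mono ?_ le_rfl
    rintro x ⟨hx, hx' | hx'⟩
    · exact absurd hx' hx
    · exact hx'

/-- The derivative of `ψ ∈ AC¹`, as an element of `L²(Ω_Λ)`; it does not depend on the chosen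
representatives, by `derivFun_ae_eq`. -/
def derivFun (Λ : ℝ) (ψ : AC1 Λ) : L2 Λ :=
  (ψ.2.choose_spec.choose_spec.memLp_glueDeriv).toLp _

theorem derivFun_ae_eq {Λ : ℝ} (ψ : AC1 Λ) {f g : ℝ → ℂ} (h : IsACRep Λ (ψ : L2 Λ) f g) :
    derivFun Λ ψ =ᵐ[volume.restrict (Omega Λ)] glueDeriv Λ f g := by
  classical
  have h0 := ψ.2.choose_spec.choose_spec
  refine (MemLp.coeFn_toLp h0.memLp_glueDeriv).trans ?_
  obtain ⟨hl, hr⟩ := h0.unique h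
  have hm : MeasurableSet (Omega Λ) :=
    ((isOpen_leftIsland Λ).union (isOpen_rightIsland Λ)).measurableSet
  filter_upwards [ae_restrict_mem hm] with x hx
  by_cases hxl : x ∈ leftIsland Λ
  · simp only [glueDeriv, piecewise_eq_of_mem _ _ _ hxl]
    exact (Filter.eventuallyEq_of_mem ((isOpen_leftIsland Λ).mem_nhds hxl) hl).deriv_eq
  · simp only [glueDeriv, piecewise_eq_of_notMem _ _ _ hxl]
    have hxr : x ∈ rightIsland Λ := hx.resolve_left hxl
    exact (Filter.eventuallyEq_of_mem ((isOpen_rightIsland Λ).mem_nhds hxr) hr).deriv_eq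

/-- The derivative as a linear map `AC¹ → L²(Ω_Λ)`. -/
def derivMap (Λ : ℝ) : AC1 Λ →ₗ[ℂ] L2 Λ where
  toFun := derivFun Λ
  map_add' := by
    classical
    intro ψ φ
    obtain ⟨f, g, h⟩ := ψ.2
    obtain ⟨f', g', h'⟩ := φ.2
    refine Lp.ext ?_
    have hl := h.left.deriv_add (isOpen_leftIsland Λ) h'.left
    have hr := h.right.deriv_add (isOpen_rightIsland Λ) h'.right
    have hm : MeasurableSet (Omega Λ) :=
      ((isOpen_leftIsland Λ).union (isOpen_rightIsland Λ)).measurableSet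
    have hl' := ae_restrict_of_ae (s := Omega Λ)
      ((ae_restrict_iff' (isOpen_leftIsland Λ).measurableSet).1 hl)
    have hr' := ae_restrict_of_ae (s := Omega Λ)
      ((ae_restrict_iff' (isOpen_rightIsland Λ).measurableSet).1 hr)
    filter_upwards [derivFun_ae_eq (ψ + φ) (h.add h'), derivFun_ae_eq ψ h, derivFun_ae_eq φ h',
      Lp.coeFn_add (derivFun Λ ψ) (derivFun Λ φ), ae_restrict_mem hm, hl', hr']
      with x h1 h2 h3 h4 hx h5 h6
    rw [h1, h4, Pi.add_apply, h2, h3]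
    by_cases hxl : x ∈ leftIsland Λ
    · simpa only [glueDeriv, piecewise_eq_of_mem _ _ _ hxl, Pi.add_apply] using h5 hxl
    · simpa only [glueDeriv, piecewise_eq_of_notMem _ _ _ hxl, Pi.add_apply] using h6 (hx.resolve_left hxl)
  map_smul' := by
    classical
    intro c ψ
    obtain ⟨f, g, h⟩ := ψ.2
    refine Lp.ext ?_
    filter_upwards [derivFun_ae_eq (c • ψ) (h.smul c), derivFun_ae_eq ψ h,
      Lp.coeFn_smul c (derivFun Λ ψ)] with x h1 h2 h3
    rw [h1, RingHom.id_apply, h3, Pi.smul_apply, h2]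
    by_cases hxl : x ∈ leftIsland Λ
    · simp only [glueDeriv, piecewise_eq_of_mem _ _ _ hxl, deriv_smul_fun, Pi.smul_apply]
    · simp only [glueDeriv, piecewise_eq_of_notMem _ _ _ hxl, deriv_smul_fun, Pi.smul_apply]

/-- The momentum operation `p = -i d/dx` on `AC₀¹`. -/
def momentum (Λ : ℝ) : AC10 Λ →ₗ[ℂ] L2 Λ :=
  (-Complex.I) • (derivMap Λ).comp (Submodule.inclusion (AC10_le_AC1 Λ))

/-- The minimal Dirac operator `H₀ = σ_x ⊗ p + m σ_z ⊗ I` with domain `ℂ² ⊗ AC₀¹`, that is,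
`H₀ (ψ↑, ψ↓) = (p ψ↓ + m ψ↑, p ψ↑ - m ψ↓)`. -/
def minimalDirac (m Λ : ℝ) : Spinor Λ →ₗ.[ℂ] Spinor Λ where
  domain :=
    { carrier := {ψ | ψ.fst ∈ AC10 Λ ∧ ψ.snd ∈ AC10 Λ}
      add_mem' := fun h h' => ⟨add_mem h.1 h'.1, add_mem h.2 h'.2⟩
      zero_mem' := ⟨zero_mem _, zero_mem _⟩
      smul_mem' := fun c _ h => ⟨Submodule.smul_mem _ c h.1, Submodule.smul_mem _ c h.2⟩ }
  toFun :=
    { toFun := fun ψ => WithLp.toLp 2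
        (momentum Λ ⟨ψ.1.snd, ψ.2.2⟩ + (m : ℂ) • ψ.1.fst,
          momentum Λ ⟨ψ.1.fst, ψ.2.1⟩ - (m : ℂ) • ψ.1.snd)
      map_add' := by
        intro ψ φ
        have h1 : momentum Λ ⟨(ψ + φ).1.snd, (ψ + φ).2.2⟩
            = momentum Λ ⟨ψ.1.snd, ψ.2.2⟩ + momentum Λ ⟨φ.1.snd, φ.2.2⟩ := by
          rw [← map_add]; rfl
        have h2 : momentum Λ ⟨(ψ + φ).1.fst, (ψ + φ).2.1⟩
            = momentum Λ ⟨ψ.1.fst, ψ.2.1⟩ + momentum Λ ⟨φ.1.fst, φ.2.1⟩ := by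
          rw [← map_add]; rfl
        rw [h1, h2, ← WithLp.toLp_add]
        congr 1
        refine Prod.ext ?_ ?_
        · simp only [Submodule.coe_add, WithLp.add_fst, Prod.fst_add, smul_add]; abel
        · simp only [Submodule.coe_add, WithLp.add_snd, Prod.snd_add, smul_add]; abel
      map_smul' := by
        intro c ψ
        have h1 : momentum Λ ⟨(c • ψ).1.snd, (c • ψ).2.2⟩
            = c • momentum Λ ⟨ψ.1.snd, ψ.2.2⟩ := by
          rw [← map_smul]; rfl
        have h2 : momentum Λ ⟨(c • ψ).1.fst, (c • ψ).2.1⟩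
            = c • momentum Λ ⟨ψ.1.fst, ψ.2.1⟩ := by
          rw [← map_smul]; rfl
        rw [h1, h2, RingHom.id_apply, ← WithLp.toLp_smul]
        congr 1
        refine Prod.ext ?_ ?_
        · simp only [Submodule.coe_smul, WithLp.smul_fst, Prod.smul_fst, smul_add,
            smul_comm c (m : ℂ)]
        · simp only [Submodule.coe_smul, WithLp.smul_snd, Prod.smul_snd, smul_sub,
            smul_comm c (m : ℂ)] }

/-- The maximal Dirac operator, the Hilbert space adjoint `H₀*`. -/
def maximalDirac (m Λ : ℝ) : Spinor Λ →ₗ.[ℂ] Spinor Λ := (minimalDirac m Λ).adjoint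

/-- `A` is a self-adjoint extension of `A₀` : `A₀ ⊂ A` and `A = A*`. -/
def IsSelfAdjointExtension {Λ : ℝ} (A₀ A : Spinor Λ →ₗ.[ℂ] Spinor Λ) : Prop :=
  A₀ ≤ A ∧ IsSelfAdjoint A

/-- `ψ(-Λ) = v` and `ψ(+Λ) = w`, where `v = (ψ↑(-Λ), ψ↓(-Λ))` and `w = (ψ↑(+Λ), ψ↓(+Λ))`. -/
def HasBoundaryValues {Λ : ℝ} (ψ : Spinor Λ) (v w : Fin 2 → ℂ) : Prop :=
  ∃ fUp gUp fDown gDown : ℝ → ℂ, IsACRep Λ ψ.fst fUp gUp ∧ IsACRep Λ ψ.snd fDown gDown ∧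
    v = ![fUp (-Λ), fDown (-Λ)] ∧ w = ![gUp Λ, gDown Λ]

/-- The subspace of all `ψ` whose boundary values `(ψ(-Λ), ψ(+Λ))` exist and satisfy the linear
boundary condition `C`. -/
def bcSpace (Λ : ℝ) (C : Submodule ℂ ((Fin 2 → ℂ) × (Fin 2 → ℂ))) : Submodule ℂ (Spinor Λ) where
  carrier := {ψ | ∃ v w, HasBoundaryValues ψ v w ∧ (v, w) ∈ C}
  add_mem' := by
    rintro ψ φ ⟨v, w, ⟨f, g, k, l, h1, h2, rfl, rfl⟩, hC⟩
      ⟨v', w', ⟨f', g', k', l', h1', h2', rfl, rfl⟩, hC'⟩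
    refine ⟨_, _, ⟨_, _, _, _, h1.add h1', h2.add h2', rfl, rfl⟩, ?_⟩
    simpa using C.add_mem hC hC'
  zero_mem' := ⟨_, _, ⟨_, _, _, _, isACRep_zero Λ, isACRep_zero Λ, rfl, rfl⟩, by
    have h : ((![0, 0], ![0, 0]) : (Fin 2 → ℂ) × (Fin 2 → ℂ)) = 0 := by simp
    simpa only [Pi.zero_apply, h] using C.zero_mem⟩
  smul_mem' := by
    rintro c ψ ⟨v, w, ⟨f, g, k, l, h1, h2, rfl, rfl⟩, hC⟩
    refine ⟨_, _, ⟨_, _, _, _, h1.smul c, h2.smul c, rfl, rfl⟩, ?_⟩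
    simpa using C.smul_mem c hC

/-- The condition at one boundary point on the value `u = (u↑, u↓)` there, with parameter
`r ∈ ℝ ∪ {+∞}`: `i r u↑ = u↓` if `r ∈ ℝ`, and `u↑ = 0` if `r = +∞`. -/
def EdgeCondition (r : WithTop ℝ) (u : Fin 2 → ℂ) : Prop :=
  (∀ t : ℝ, r = (t : WithTop ℝ) → Complex.I * (t : ℂ) * u 0 = u 1) ∧ (r = ⊤ → u 0 = 0)

/-- The separated boundary condition with parameters `ρ₊` (at `+Λ`) and `ρ₋` (at `-Λ`), on the
pairs `(ψ(-Λ), ψ(+Λ))`. -/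
def bcRho (ρplus ρminus : WithTop ℝ) : Submodule ℂ ((Fin 2 → ℂ) × (Fin 2 → ℂ)) where
  carrier := {x | EdgeCondition ρplus x.2 ∧ EdgeCondition ρminus x.1}
  add_mem' := by
    rintro x y ⟨⟨a, b⟩, ⟨c, d⟩⟩ ⟨⟨a', b'⟩, ⟨c', d'⟩⟩
    refine ⟨⟨fun t ht => ?_, fun h => ?_⟩, ⟨fun t ht => ?_, fun h => ?_⟩⟩
    · simp [mul_add, a t ht, a' t ht]
    · simp [b h, b' h]
    · simp [mul_add, c t ht, c' t ht]
    · simp [d h, d' h]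
  zero_mem' := by simp [EdgeCondition]
  smul_mem' := by
    rintro z x ⟨⟨a, b⟩, ⟨c, d⟩⟩
    refine ⟨⟨fun t ht => ?_, fun h => ?_⟩, ⟨fun t ht => ?_, fun h => ?_⟩⟩
    · simp only [Prod.smul_snd, Pi.smul_apply, smul_eq_mul, ← a t ht]; ring
    · simp [b h]
    · simp only [Prod.smul_fst, Pi.smul_apply, smul_eq_mul, ← c t ht]; ring
    · simp [d h]

/-- The class of parameters `α = (α₁, α₂, α₃, α₄) ∈ ℂ⁴` (indexed here by `0, 1, 2, 3`). -/
def ClassAlpha (α : Fin 4 → ℂ) : Prop :=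
  (α 0 * star (α 1)).re = 0 ∧ (α 0 * star (α 2)).re = 0 ∧
  (α 1 * star (α 3)).re = 0 ∧ (α 2 * star (α 3)).re = 0 ∧
  α 0 * star (α 3) + α 1 * star (α 2) = 1 ∧ α 0 * star (α 3) + star (α 1) * α 2 = 1

/-- The boundary matrix `B_α`. -/
def boundaryMatrix (α : Fin 4 → ℂ) : Matrix (Fin 2) (Fin 2) ℂ :=
  !![α 0, α 1; α 2, α 3]

/-- The transmitting boundary condition `ψ(+Λ) = B_α ψ(-Λ)`, on the pairs `(ψ(-Λ), ψ(+Λ))`. -/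
def bcAlpha (α : Fin 4 → ℂ) : Submodule ℂ ((Fin 2 → ℂ) × (Fin 2 → ℂ)) where
  carrier := {x | x.2 = (boundaryMatrix α).mulVec x.1}
  add_mem' := by
    intro x y hx hy
    simp only [mem_ofPred_eq] at hx hy ⊢
    rw [Prod.snd_add, Prod.fst_add, Matrix.mulVec_add, hx, hy]
  zero_mem' := (Matrix.mulVec_zero (boundaryMatrix α)).symm
  smul_mem' := by
    intro c x hx
    simp only [mem_ofPred_eq] at hx ⊢
    rw [Prod.smul_snd, Prod.smul_fst, Matrix.mulVec_smul, hx]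

/-- `H_ρ`, the restriction of `H₀*` to those `ψ ∈ D(H₀*)` that satisfy the separated boundary
condition with parameters `ρ = (ρ₊, ρ₋)`. -/
def diracRho (m Λ : ℝ) (ρplus ρminus : WithTop ℝ) : Spinor Λ →ₗ.[ℂ] Spinor Λ :=
  (maximalDirac m Λ).domRestrict (bcSpace Λ (bcRho ρplus ρminus))

/-- `H_α`, the restriction of `H₀*` to those `ψ ∈ D(H₀*)` that satisfy the transmitting boundary
condition `ψ(+Λ) = B_α ψ(-Λ)`. -/
def diracAlpha (m Λ : ℝ) (α : Fin 4 → ℂ) : Spinor Λ →ₗ.[ℂ] Spinor Λ :=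
  (maximalDirac m Λ).domRestrict (bcSpace Λ (bcAlpha α))

end DiracJunction

end

/-!
The proof identifies the self-adjoint extensions of `H₀` with the Lagrangian subspaces of a
four-dimensional space of boundary values, and then classifies these subspaces.

*The adjoint.* If `χ = H₀* ψ`, testing with the spinors `(φ, 0)` and `(0, φ)` shows that both
components of `ψ` have a weak derivative in `L²(Ω_Λ)`, where the test functions `φ` range over
`AC₀¹`. By the du Bois-Reymond argument (`exists_isAC1On_of_weak_deriv`) such a component differs
from a primitive of its weak derivative by one constant on each island. So `D(H₀*)` consists of the
spinors with `AC¹` components and `H₀*` acts by the same differential expression as `H₀`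
(`mem_maximalDirac_domain_iff`, `maximalDirac_apply`). The density of `D(H₀)` is the same fact,
applied to the weak derivative of `0`.

*The boundary form.* Integration by parts on the half-lines gives
`⟪H₀* ψ, φ⟫ - ⟪ψ, H₀* φ⟫ = i b(ψ, φ)`, where `b = boundaryForm` only involves the boundary values:
it is `⟪σₓ ψ(-Λ), φ(-Λ)⟫ - ⟪σₓ ψ(+Λ), φ(+Λ)⟫`. The boundary values are well defined, take all values
in `ℂ² × ℂ²`, and vanish exactly on `D(H₀)`. Hence the self-adjoint extensions of `H₀` are the
restrictions of `H₀*` by the subspaces `C` of `ℂ² × ℂ²` that equal their own `b`-orthogonal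
complement (`isSelfAdjointExtension_iff`), and `C` is determined by the operator
(`diracBC_injective`).

*The classification.* Let `C` be such a subspace. If it contains a nonzero vector `(u, 0)` or
`(0, u)`, then `u` is isotropic for `⟪σₓ u, u⟫ = 2 Re (u₀* u₁)`, so `u₀ = 0` or `u₁ = i t u₀` with
`t` real; a vector of the one kind forces one of the other kind, and `C` is the product of two
isotropic lines, which is the separated condition. Otherwise `C` is the graph of a matrix `B` with
`B* σₓ B = σₓ`, and since a left inverse of a square matrix is a right inverse this is equivalent
to `ClassAlpha` (`isLagrangian_iff`). A product of lines contains some `(0, w)` with `w ≠ 0` and a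
graph does not, so no operator is of both kinds.
-/

open Filter Topology
open scoped InnerProductSpace

noncomputable section

namespace DiracJunction

/-! ### Absolutely continuous complex functions on half-lines -/

theorem _root_.AbsolutelyContinuousOnInterval.congr {X : Type*} [PseudoMetricSpace X]
    {f g : ℝ → X} {a b : ℝ} (hf : AbsolutelyContinuousOnInterval f a b)
    (h : EqOn f g (uIcc a b)) : AbsolutelyContinuousOnInterval g a b := by
  refine Tendsto.congr' ?_ hf
  filter_upwards [mem_inf_of_right (mem_principal_self _)] with E hE
  refine Finset.sum_congr rfl fun i hi => ?_
  rw [h (hE.1 i hi).1, h (hE.1 i hi).2]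

theorem _root_.LipschitzWith.comp_absolutelyContinuousOnInterval {X Y : Type*}
    [PseudoMetricSpace X] [PseudoMetricSpace Y] {K : NNReal} {L : X → Y} (hL : LipschitzWith K L)
    {f : ℝ → X} {a b : ℝ} (hf : AbsolutelyContinuousOnInterval f a b) :
    AbsolutelyContinuousOnInterval (L ∘ f) a b := by
  refine squeeze_zero (fun E => Finset.sum_nonneg fun i _ => dist_nonneg) (fun E => ?_)
    (by simpa using Tendsto.const_mul (K : ℝ) hf)
  rw [Finset.mul_sum]
  exact Finset.sum_le_sum fun i _ => hL.dist_le_mul _ _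

/-- Complex-valued version of
`IntervalIntegrable.absolutelyContinuousOnInterval_intervalIntegral`. -/
theorem absolutelyContinuousOnInterval_intervalIntegral {f : ℝ → ℂ} {a b c : ℝ}
    (h : IntervalIntegrable f volume a b) (hc : c ∈ uIcc a b) :
    AbsolutelyContinuousOnInterval (fun x => ∫ v in c..x, f v) a b := by
  have hre : IntervalIntegrable (fun x => (f x).re) volume a b :=
    ⟨h.1.re, h.2.re⟩
  have him : IntervalIntegrable (fun x => (f x).im) volume a b :=
    ⟨h.1.im, h.2.im⟩
  have h1 := Complex.isometry_ofReal.lipschitz.comp_absolutelyContinuousOnInterval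
    (hre.absolutelyContinuousOnInterval_intervalIntegral hc)
  have h2 := (Complex.isometry_ofReal.lipschitz.comp_absolutelyContinuousOnInterval
    (him.absolutelyContinuousOnInterval_intervalIntegral hc)).const_smul Complex.I
  refine (h1.add h2).congr fun x hx => ?_
  have hi : IntervalIntegrable f volume c x := h.mono_set (uIcc_subset_uIcc hc hx)
  have e1 := Complex.reCLM.intervalIntegral_comp_comm hi
  have e2 := Complex.imCLM.intervalIntegral_comp_comm hi
  simp only [Complex.reCLM_apply, Complex.imCLM_apply] at e1 e2
  simp only [Pi.add_apply, Function.comp_apply, smul_eq_mul, e1, e2]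
  rw [mul_comm, Complex.re_add_im]

/-- The fundamental theorem of calculus for complex-valued absolutely continuous functions. -/
theorem integral_eq_sub_of_absolutelyContinuousOnInterval {f f' : ℝ → ℂ} {a b : ℝ}
    (hf : AbsolutelyContinuousOnInterval f a b)
    (hd : ∀ᵐ x, x ∈ uIcc a b → HasDerivAt f (f' x) x) (hi : IntervalIntegrable f' volume a b) :
    ∫ x in a..b, f' x = f b - f a := by
  have hac := hf.sub (absolutelyContinuousOnInterval_intervalIntegral hi left_mem_uIcc)
  have h0 : ∀ᵐ x, x ∈ uIcc a b → HasDerivAt (f - fun x => ∫ v in a..x, f' v) 0 x := by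
    filter_upwards [hd, hi.ae_hasDerivAt_integral] with x h1 h2 hx
    simpa using (h1 hx).sub (h2 hx a left_mem_uIcc)
  obtain ⟨C, hC⟩ := hac.const_of_ae_hasDerivAt_zero h0
  have ha := hC a left_mem_uIcc
  have hb := hC b right_mem_uIcc
  simp only [Pi.sub_apply, intervalIntegral.integral_same, sub_zero] at ha hb
  rw [ha, ← hb]; ring

/-- Both `f` and `f'` are integrable, so `f` tends to `0` at infinity. -/
theorem integral_Ioi_eq_neg_of_absolutelyContinuousOnInterval {f f' : ℝ → ℂ} {a : ℝ}
    (hac : ∀ b, a ≤ b → AbsolutelyContinuousOnInterval f a b)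
    (hd : ∀ᵐ x ∂(volume.restrict (Ioi a)), HasDerivAt f (f' x) x)
    (hf : IntegrableOn f (Ioi a)) (hf' : IntegrableOn f' (Ioi a)) :
    ∫ x in Ioi a, f' x = -f a := by
  have key : ∀ b, a ≤ b → ∫ x in a..b, f' x = f b - f a := fun b hab => by
    refine integral_eq_sub_of_absolutelyContinuousOnInterval (hac b hab) ?_
      ((intervalIntegrable_iff_integrableOn_Ioc_of_le hab).2 (hf'.mono_set Ioc_subset_Ioi_self))
    filter_upwards [(ae_restrict_iff' measurableSet_Ioi).1 hd, Measure.ae_ne volume a]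
      with x h1 h2 hx
    rw [uIcc_of_le hab] at hx
    exact h1 (lt_of_le_of_ne hx.1 h2.symm)
  have hlim := intervalIntegral_tendsto_integral_Ioi a hf' tendsto_id
  have hlim' : Tendsto f atTop (𝓝 ((∫ x in Ioi a, f' x) + f a)) := by
    refine (hlim.add_const (f a)).congr' ?_
    filter_upwards [eventually_ge_atTop a] with b hb
    rw [id, key b hb]; ring
  have h0 := IntegrableAtFilter.eq_zero_of_tendsto (μ := volume)
    ⟨Ioi a, Ioi_mem_atTop a, hf⟩ (fun s hs => by
      obtain ⟨b, hb⟩ := mem_atTop_sets.1 hs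
      rw [← top_le_iff, ← Real.volume_Ici (a := b)]
      exact measure_mono hb) hlim'
  exact eq_neg_of_add_eq_zero_left h0

theorem integral_Iio_eq_of_absolutelyContinuousOnInterval {f f' : ℝ → ℂ} {a : ℝ}
    (hac : ∀ b, b ≤ a → AbsolutelyContinuousOnInterval f b a)
    (hd : ∀ᵐ x ∂(volume.restrict (Iio a)), HasDerivAt f (f' x) x)
    (hf : IntegrableOn f (Iio a)) (hf' : IntegrableOn f' (Iio a)) :
    ∫ x in Iio a, f' x = f a := by
  have hf'' : IntegrableOn f' (Iic a) := by rwa [integrableOn_Iic_iff_integrableOn_Iio]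
  have key : ∀ b, b ≤ a → ∫ x in b..a, f' x = f a - f b := fun b hab => by
    refine integral_eq_sub_of_absolutelyContinuousOnInterval (hac b hab) ?_
      ((intervalIntegrable_iff_integrableOn_Ioc_of_le hab).2 (hf''.mono_set Ioc_subset_Iic_self))
    filter_upwards [(ae_restrict_iff' measurableSet_Iio).1 hd, Measure.ae_ne volume a]
      with x h1 h2 hx
    rw [uIcc_of_le hab] at hx
    exact h1 (lt_of_le_of_ne hx.2 h2)
  have hlim := intervalIntegral_tendsto_integral_Iic a hf'' tendsto_id
  rw [integral_Iic_eq_integral_Iio] at hlim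
  have hlim' : Tendsto f atBot (𝓝 (f a - (∫ x in Iio a, f' x))) := by
    refine (hlim.const_sub (f a)).congr' ?_
    filter_upwards [eventually_le_atBot a] with b hb
    rw [id, key b hb]; ring
  have h0 := IntegrableAtFilter.eq_zero_of_tendsto (μ := volume)
    ⟨Iio a, Iio_mem_atBot a, hf⟩ (fun s hs => by
      obtain ⟨b, hb⟩ := mem_atBot_sets.1 hs
      rw [← top_le_iff, ← Real.volume_Iic (a := b)]
      exact measure_mono hb) hlim'
  exact (sub_eq_zero.1 h0).symm

theorem lipschitzWith_star : LipschitzWith 1 (star : ℂ → ℂ) :=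
  (starₗᵢ ℂ (E := ℂ)).lipschitz

section Product

variable {I : Set ℝ} {f g : ℝ → ℂ}

theorem integrableOn_star_mul_of_memLp (hf : MemLp f 2 (volume.restrict I))
    (hg : MemLp g 2 (volume.restrict I)) : IntegrableOn (fun x => star (f x) * g x) I := by
  have h := hf.star.integrable_mul hg
  exact h

theorem IsAC1On.absolutelyContinuousOnInterval_star_mul (hf : IsAC1On I f) (hg : IsAC1On I g)
    {a b : ℝ} (ha : a ∈ closure I) (hb : b ∈ closure I) :
    AbsolutelyContinuousOnInterval (fun x => star (f x) * g x) a b :=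
  (lipschitzWith_star.comp_absolutelyContinuousOnInterval (hf.ac a ha b hb)).smul
    (hg.ac a ha b hb)

theorem IsAC1On.ae_hasDerivAt_star_mul (hI : IsOpen I) (hf : IsAC1On I f) (hg : IsAC1On I g) :
    ∀ᵐ x ∂(volume.restrict I), HasDerivAt (fun x => star (f x) * g x)
      (star (deriv f x) * g x + star (f x) * deriv g x) x := by
  filter_upwards [hf.ae_differentiableAt hI, hg.ae_differentiableAt hI] with x h1 h2
  exact h1.hasDerivAt.star.mul h2.hasDerivAt

theorem IsAC1On.integral_Ioi_by_parts {a : ℝ} (hf : IsAC1On (Ioi a) f) (hg : IsAC1On (Ioi a) g) :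
    (∫ x in Ioi a, star (deriv f x) * g x) + ∫ x in Ioi a, star (f x) * deriv g x
      = -(star (f a) * g a) := by
  have hi1 := integrableOn_star_mul_of_memLp hf.memLp_deriv hg.memLp
  have hi2 := integrableOn_star_mul_of_memLp hf.memLp hg.memLp_deriv
  rw [← integral_add hi1 hi2]
  refine integral_Ioi_eq_neg_of_absolutelyContinuousOnInterval
    (f := fun x => star (f x) * g x) (fun b hb => ?_)
    (hf.ae_hasDerivAt_star_mul isOpen_Ioi hg)
    (integrableOn_star_mul_of_memLp hf.memLp hg.memLp) (hi1.add hi2)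
  exact hf.absolutelyContinuousOnInterval_star_mul hg (by simp) (by simpa using hb)

theorem IsAC1On.integral_Iio_by_parts {a : ℝ} (hf : IsAC1On (Iio a) f) (hg : IsAC1On (Iio a) g) :
    (∫ x in Iio a, star (deriv f x) * g x) + ∫ x in Iio a, star (f x) * deriv g x
      = star (f a) * g a := by
  have hi1 := integrableOn_star_mul_of_memLp hf.memLp_deriv hg.memLp
  have hi2 := integrableOn_star_mul_of_memLp hf.memLp hg.memLp_deriv
  rw [← integral_add hi1 hi2]
  refine integral_Iio_eq_of_absolutelyContinuousOnInterval
    (f := fun x => star (f x) * g x) (fun b hb => ?_)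
    (hf.ae_hasDerivAt_star_mul isOpen_Iio hg)
    (integrableOn_star_mul_of_memLp hf.memLp hg.memLp) (hi1.add hi2)
  exact hf.absolutelyContinuousOnInterval_star_mul hg (by simpa using hb) (by simp)

end Product

/-! ### Weak derivatives in `L²` -/

/-- The du Bois-Reymond lemma in `L²`: the test function is the deviation of `w` from its mean. -/
theorem ae_const_of_forall_integral_star_mul_eq_zero {p q : ℝ} (hpq : p < q) {w : ℝ → ℂ}
    (hw : MemLp w 2 (volume.restrict (Ioo p q)))
    (h : ∀ k : ℝ → ℂ, MemLp k 2 volume → (∀ x, x ∉ Ioo p q → k x = 0) →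
      ∫ x in Ioo p q, k x = 0 → ∫ x in Ioo p q, star (w x) * k x = 0) :
    ∃ c : ℂ, ∀ᵐ x ∂(volume.restrict (Ioo p q)), w x = c := by
  have hwi : IntegrableOn w (Ioo p q) := hw.integrable one_le_two
  -- `c` is the mean of `w`, so that `w - c` is an admissible test function.
  set c : ℂ := (∫ x in Ioo p q, w x) / ((q - p : ℝ) : ℂ) with hc
  have hne : ((q - p : ℝ) : ℂ) ≠ 0 := by
    exact_mod_cast (sub_pos.2 hpq).ne'
  have hwc : MemLp (fun x => w x - c) 2 (volume.restrict (Ioo p q)) := hw.sub (memLp_const c)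
  set k : ℝ → ℂ := (Ioo p q).indicator fun x => w x - c with hk
  have hkeq : ∀ x ∈ Ioo p q, k x = w x - c := fun x hx => indicator_of_mem hx _
  have hk0 : ∫ x in Ioo p q, k x = 0 := by
    rw [setIntegral_congr_fun measurableSet_Ioo hkeq, integral_sub hwi (integrable_const c)]
    simp only [integral_const, measureReal_restrict_apply_univ, Real.volume_real_Ioo_of_le hpq.le,
      hc, Complex.real_smul]
    field_simp
    simp
  have hkL : MemLp k 2 volume := (memLp_indicator_iff_restrict measurableSet_Ioo).2 hwc
  have h1 := h k hkL (fun x hx => indicator_of_notMem hx _) hk0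
  have h2 : ∫ x in Ioo p q, star c * k x = 0 := by rw [integral_const_mul, hk0, mul_zero]
  have hki : IntegrableOn k (Ioo p q) := (hkL.restrict _).integrable one_le_two
  have h3 : ∫ x in Ioo p q, ((‖w x - c‖ ^ 2 : ℝ) : ℂ) = 0 := by
    have h4 := integral_sub (integrableOn_star_mul_of_memLp hw (hkL.restrict _))
      (hki.const_mul (star c))
    rw [h1, h2, sub_zero] at h4
    rw [← h4]
    refine setIntegral_congr_fun measurableSet_Ioo fun x hx => ?_
    simp only [hkeq x hx]
    rw [← sub_mul, ← star_sub, mul_comm]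
    exact (RCLike.mul_conj (w x - c)).symm ▸ by norm_cast
  rw [integral_complex_ofReal] at h3
  have h4 := (integral_eq_zero_iff_of_nonneg (fun x => by positivity)
    hwc.integrable_norm_pow').1 (by exact_mod_cast h3)
  refine ⟨c, ?_⟩
  filter_upwards [h4] with x hx
  have : ‖w x - c‖ ^ 2 = 0 := hx
  exact sub_eq_zero.1 (norm_eq_zero.1 (pow_eq_zero_iff two_ne_zero |>.1 this))

/-- The constants on the members of an increasing sequence of sets agree, because all of them
are taken on the first set, which is not null. -/
theorem ae_const_iUnion {s : ℕ → Set ℝ} (hs : Monotone s) (h0 : volume (s 0) ≠ 0) {g : ℝ → ℂ}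
    (h : ∀ n, ∃ c : ℂ, ∀ᵐ x ∂(volume.restrict (s n)), g x = c) :
    ∃ c : ℂ, ∀ᵐ x ∂(volume.restrict (⋃ n, s n)), g x = c := by
  choose c hc using h
  refine ⟨c 0, ae_restrict_iUnion_iff _ _ |>.2 fun n => ?_⟩
  have h1 : ∀ᵐ x ∂(volume.restrict (s 0)), g x = c n :=
    ae_mono (Measure.restrict_mono (hs (Nat.zero_le n)) le_rfl) (hc n)
  have : NeBot (ae (volume.restrict (s 0))) := by
    rw [ae_neBot]; simpa using h0
  obtain ⟨x, hx, hx'⟩ := ((hc 0).and h1).exists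
  rw [← hx, hx']
  exact hc n

theorem intervalIntegrable_of_memLp {k : ℝ → ℂ} (hk : MemLp k 2 volume) (a b : ℝ) :
    IntervalIntegrable k volume a b :=
  ((hk.locallyIntegrable one_le_two).integrableOn_isCompact isCompact_uIcc).intervalIntegrable

theorem ae_hasDerivAt_primitive {k : ℝ → ℂ} (hk : MemLp k 2 volume) (c : ℝ) :
    ∀ᵐ x, HasDerivAt (fun x => ∫ t in c..x, k t) (k x) x := by
  filter_upwards [LocallyIntegrable.ae_hasDerivAt_integral (hk.locallyIntegrable one_le_two)]
    with x hx
  exact hx c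

theorem absolutelyContinuousOnInterval_primitive {k : ℝ → ℂ} (hk : MemLp k 2 volume)
    (c a b : ℝ) : AbsolutelyContinuousOnInterval (fun x => ∫ t in c..x, k t) a b := by
  have h := absolutelyContinuousOnInterval_intervalIntegral
    (intervalIntegrable_of_memLp hk (min c (min a b)) (max c (max a b))) (c := c)
    (by rw [mem_uIcc]; left; simp)
  refine h.mono ?_
  rw [uIcc_subset_uIcc_iff_mem, mem_uIcc, mem_uIcc]
  simp

/-- The primitive of a mean-zero `L²` function supported in `(p, q)` again vanishes outside
`(p, q)`. -/
theorem primitive_eq_zero {p q : ℝ} {k : ℝ → ℂ}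
    (hk : ∀ x, x ∉ Ioo p q → k x = 0) (h0 : ∫ x in Ioo p q, k x = 0) {x : ℝ} (hx : x ∉ Ioo p q) :
    ∫ t in p..x, k t = 0 := by
  rcases le_or_gt x p with h | h
  · rw [intervalIntegral.integral_symm, intervalIntegral.integral_of_le h,
      setIntegral_congr_fun measurableSet_Ioc (g := fun _ => 0)]
    · simp
    · intro t ht
      exact hk t fun ht' => absurd ht'.1 (not_lt.2 ht.2)
  · have hq : q ≤ x := not_lt.1 fun hq => hx ⟨h, hq⟩
    rw [intervalIntegral.integral_of_le h.le, ← h0,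
      setIntegral_eq_of_subset_of_forall_sdiff_eq_zero measurableSet_Ioc
        (fun t ht => ⟨ht.1, ht.2.le.trans hq⟩) (fun t ht => hk t ht.2)]

theorem isAC1On_primitive {p q : ℝ} {k : ℝ → ℂ} (hkL : MemLp k 2 volume)
    (hk : ∀ x, x ∉ Ioo p q → k x = 0) (h0 : ∫ x in Ioo p q, k x = 0) (I : Set ℝ) :
    IsAC1On I (fun x => ∫ t in p..x, k t) where
  memLp := by
    have hcont : Continuous fun x => ∫ t in p..x, k t :=
      intervalIntegral.continuous_primitive (fun a b => intervalIntegrable_of_memLp hkL a b) p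
    refine (hcont.memLp_of_hasCompactSupport (p := 2) (μ := volume) ?_).restrict I
    exact HasCompactSupport.intro (isCompact_Icc (a := p) (b := q)) fun x hx =>
      primitive_eq_zero hk h0 fun hx' => hx (Ioo_subset_Icc_self hx')
  ac a _ b _ := absolutelyContinuousOnInterval_primitive hkL p a b
  memLp_deriv := by
    refine (hkL.ae_eq ?_).restrict I
    filter_upwards [ae_hasDerivAt_primitive hkL p] with x hx
    exact hx.deriv.symm

/-- A function of `L²(I)` with a weak derivative in `L²(I)` has an `AC¹` representative: it differs
from a primitive of its weak derivative by a constant. It suffices to test with `AC¹` functions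
that vanish outside `I`. -/
theorem exists_isAC1On_of_weak_deriv {I : Set ℝ} (hI : MeasurableSet I) {p q : ℕ → ℝ}
    (hp : Antitone p) (hq : Monotone q) (hpq : p 0 < q 0) (hU : ⋃ n, Ioo (p n) (q n) = I)
    {u v : ℝ → ℂ} (hu : MemLp u 2 (volume.restrict I)) (hv : MemLp v 2 (volume.restrict I))
    (h : ∀ φ : ℝ → ℂ, IsAC1On I φ → (∀ x, x ∉ I → φ x = 0) →
      ∫ x in I, star (u x) * deriv φ x = -∫ x in I, star (v x) * φ x) :
    ∃ f, IsAC1On I f ∧ u =ᵐ[volume.restrict I] f ∧ deriv f =ᵐ[volume.restrict I] v := by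
  -- Extending `v` by zero gives a primitive `F` that is defined on the whole line.
  set v0 := I.indicator v with hv0
  have hv0L : MemLp v0 2 volume := (memLp_indicator_iff_restrict hI).2 hv
  set F : ℝ → ℂ := fun x => ∫ t in (p 0)..x, v0 t with hF
  have hFac := absolutelyContinuousOnInterval_primitive hv0L (p 0)
  have hFcont : Continuous F :=
    intervalIntegral.continuous_primitive (fun a b => intervalIntegrable_of_memLp hv0L a b) _
  have hlt : ∀ n, p n < q n := fun n =>
    (hp (Nat.zero_le n)).trans_lt (hpq.trans_le (hq (Nat.zero_le n)))
  have hsub : ∀ n, Ioo (p n) (q n) ⊆ I := fun n => hU ▸ subset_iUnion_of_subset n subset_rfl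
  have key : ∀ n, ∃ c : ℂ, ∀ᵐ x ∂(volume.restrict (Ioo (p n) (q n))), u x - F x = c := by
    intro n
    have huJ : MemLp u 2 (volume.restrict (Ioo (p n) (q n))) :=
      hu.mono_measure (Measure.restrict_mono (hsub n) le_rfl)
    have hFJ : MemLp F 2 (volume.restrict (Ioo (p n) (q n))) := by
      obtain ⟨C, hC⟩ := (isCompact_Icc (a := p n) (b := q n)).exists_bound_of_continuousOn
        hFcont.continuousOn
      refine MemLp.of_bound hFcont.aestronglyMeasurable C ?_
      filter_upwards [ae_restrict_mem measurableSet_Ioo] with x hx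
      exact hC x (Ioo_subset_Icc_self hx)
    refine ae_const_of_forall_integral_star_mul_eq_zero (hlt n) (huJ.sub hFJ) ?_
    intro k hkL hk hk0
    set φ : ℝ → ℂ := fun x => ∫ t in (p n)..x, k t with hφ
    have hφ0 : ∀ x, x ∉ Ioo (p n) (q n) → φ x = 0 := fun x hx =>
      primitive_eq_zero hk hk0 hx
    have hφac := isAC1On_primitive hkL hk hk0
    have h1 := h φ (hφac I) fun x hx => hφ0 x fun hx' => hx (hsub n hx')
    have hφd := ae_hasDerivAt_primitive hkL (p n)
    have e1 : ∫ x in I, star (u x) * deriv φ x = ∫ x in Ioo (p n) (q n), star (u x) * k x := by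
      rw [← setIntegral_eq_of_subset_of_forall_sdiff_eq_zero hI (hsub n)
        (fun t ht => by rw [hk t ht.2, mul_zero])]
      refine integral_congr_ae (ae_restrict_of_ae ?_)
      filter_upwards [hφd] with x hx
      rw [hx.deriv]
    have e2 : ∫ x in I, star (v x) * φ x = ∫ x in Ioo (p n) (q n), star (v0 x) * φ x := by
      rw [setIntegral_eq_of_subset_of_forall_sdiff_eq_zero hI (hsub n)
        (fun t ht => by rw [hφ0 t ht.2, mul_zero])]
      refine setIntegral_congr_fun measurableSet_Ioo fun x hx => ?_
      simp only [hv0, indicator_of_mem (hsub n hx)]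
    have hkJ := hkL.restrict (Ioo (p n) (q n))
    have i1 := integrableOn_star_mul_of_memLp (hv0L.restrict (Ioo (p n) (q n)))
      (hφac (Ioo (p n) (q n))).memLp
    have i2 := integrableOn_star_mul_of_memLp hFJ hkJ
    -- Integration by parts for `F` and `φ`: the boundary terms vanish.
    have e3 : (∫ x in Ioo (p n) (q n), star (v0 x) * φ x)
        + ∫ x in Ioo (p n) (q n), star (F x) * k x = 0 := by
      rw [← integral_add i1 i2]
      have hac : AbsolutelyContinuousOnInterval (fun x => star (F x) * φ x) (p n) (q n) :=
        (lipschitzWith_star.comp_absolutelyContinuousOnInterval (hFac (p n) (q n))).smul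
          (absolutelyContinuousOnInterval_primitive hkL (p n) (p n) (q n))
      have := integral_eq_sub_of_absolutelyContinuousOnInterval
        (f' := fun x => star (v0 x) * φ x + star (F x) * k x) hac (by
          filter_upwards [hφd, ae_hasDerivAt_primitive hv0L (p 0)] with x a b _
          exact b.star.mul a)
        ((intervalIntegrable_iff_integrableOn_Ioo_of_le (hlt n).le).2 (i1.add i2))
      rw [intervalIntegral.integral_of_le (hlt n).le, integral_Ioc_eq_integral_Ioo,
        hφ0 _ (by simp), hφ0 _ (by simp)] at this
      simpa using this
    simp only [star_sub, sub_mul]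
    rw [integral_sub (integrableOn_star_mul_of_memLp huJ hkJ) i2, ← e1, h1, e2,
      ← neg_add', e3, neg_zero]
  obtain ⟨c, hc⟩ := ae_const_iUnion (s := fun n => Ioo (p n) (q n))
    (fun i j hij => Ioo_subset_Ioo (hp hij) (hq hij)) (by simp [hpq]) key
  rw [hU] at hc
  have hae : u =ᵐ[volume.restrict I] fun x => F x + c := by
    filter_upwards [hc] with x hx
    rw [← hx]; ring
  have hd : deriv (fun x => F x + c) =ᵐ[volume.restrict I] v := by
    filter_upwards [ae_restrict_of_ae (ae_hasDerivAt_primitive hv0L (p 0)), ae_restrict_mem hI]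
      with x hx hxI
    rw [(hx.add_const c).deriv, hv0, indicator_of_mem hxI]
  refine ⟨fun x => F x + c, ⟨hu.ae_eq hae, fun a _ b _ => ?_, hv.ae_eq hd.symm⟩, hae, hd⟩
  refine (hFac a b).add (g := fun _ => c) ?_
  exact contDiff_const.contDiffOn.absolutelyContinuousOnInterval

/-! ### The derivative on the two islands -/

section Scalar

variable {Λ : ℝ}

theorem disjoint_islands (hΛ : 0 ≤ Λ) : Disjoint (leftIsland Λ) (rightIsland Λ) := by
  rw [Set.disjoint_left]
  intro x (hx : x < -Λ) (hx' : Λ < x)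
  linarith

theorem measurableSet_leftIsland (Λ : ℝ) : MeasurableSet (leftIsland Λ) := measurableSet_Iio

theorem measurableSet_rightIsland (Λ : ℝ) : MeasurableSet (rightIsland Λ) := measurableSet_Ioi

open Classical in
/-- Representatives on the two islands can be glued; the islands are disjoint as `Λ ≥ 0`. -/
theorem exists_isACRep (hΛ : 0 ≤ Λ) {f g : ℝ → ℂ} (hf : IsAC1On (leftIsland Λ) f)
    (hg : IsAC1On (rightIsland Λ) g) : ∃ ψ : L2 Λ, IsACRep Λ ψ f g := by
  have hL : MemLp ((leftIsland Λ).piecewise f g) 2 (volume.restrict (Omega Λ)) := by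
    refine MemLp.piecewise (measurableSet_leftIsland Λ) ?_ ?_
    · exact hf.memLp.mono_measure (Measure.restrict_mono_measure Measure.restrict_le_self _)
    · refine hg.memLp.mono_measure ?_
      rw [Measure.restrict_restrict (measurableSet_leftIsland Λ).compl]
      refine Measure.restrict_mono ?_ le_rfl
      rintro x ⟨hx, hx' | hx'⟩
      · exact absurd hx' hx
      · exact hx'
  refine ⟨hL.toLp _, hf, hg, ?_, ?_⟩
  · filter_upwards [ae_left_of_ae hL.coeFn_toLp, ae_restrict_mem (measurableSet_leftIsland Λ)]
      with x hx hxl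
    rw [hx, piecewise_eq_of_mem _ _ _ hxl]
  · filter_upwards [ae_right_of_ae hL.coeFn_toLp, ae_restrict_mem (measurableSet_rightIsland Λ)]
      with x hx hxr
    rw [hx, piecewise_eq_of_notMem _ _ _ (Set.disjoint_right.1 (disjoint_islands hΛ) hxr)]

theorem inner_eq_integral_add (hΛ : 0 ≤ Λ) {u φ : L2 Λ} {f g f' g' : ℝ → ℂ}
    (hf : u =ᵐ[volume.restrict (leftIsland Λ)] f) (hg : u =ᵐ[volume.restrict (rightIsland Λ)] g)
    (hf' : φ =ᵐ[volume.restrict (leftIsland Λ)] f')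
    (hg' : φ =ᵐ[volume.restrict (rightIsland Λ)] g') :
    ⟪u, φ⟫_ℂ = (∫ x in leftIsland Λ, star (f x) * f' x)
      + ∫ x in rightIsland Λ, star (g x) * g' x := by
  have hi : IntegrableOn (fun x => ⟪u x, φ x⟫_ℂ) (Omega Λ) := L2.integrable_inner u φ
  rw [L2.inner_def]
  change ∫ x in leftIsland Λ ∪ rightIsland Λ, ⟪u x, φ x⟫_ℂ = _
  rw [setIntegral_union (disjoint_islands hΛ) (measurableSet_rightIsland Λ)
    (hi.mono_set subset_union_left) (hi.mono_set subset_union_right)]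
  congr 1
  · refine integral_congr_ae ?_
    filter_upwards [hf, hf'] with x h1 h2
    rw [h1, h2, RCLike.inner_apply, mul_comm]; rfl
  · refine integral_congr_ae ?_
    filter_upwards [hg, hg'] with x h1 h2
    rw [h1, h2, RCLike.inner_apply, mul_comm]; rfl

theorem derivMap_ae_left (ψ : AC1 Λ) {f g : ℝ → ℂ} (h : IsACRep Λ (ψ : L2 Λ) f g) :
    derivMap Λ ψ =ᵐ[volume.restrict (leftIsland Λ)] deriv f := by
  classical
  filter_upwards [ae_left_of_ae (derivFun_ae_eq ψ h), ae_restrict_mem (measurableSet_leftIsland Λ)]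
    with x hx hxl
  change derivFun Λ ψ x = _
  rw [hx, glueDeriv, piecewise_eq_of_mem _ _ _ hxl]

theorem derivMap_ae_right (hΛ : 0 ≤ Λ) (ψ : AC1 Λ) {f g : ℝ → ℂ}
    (h : IsACRep Λ (ψ : L2 Λ) f g) :
    derivMap Λ ψ =ᵐ[volume.restrict (rightIsland Λ)] deriv g := by
  classical
  filter_upwards [ae_right_of_ae (derivFun_ae_eq ψ h),
    ae_restrict_mem (measurableSet_rightIsland Λ)] with x hx hxr
  change derivFun Λ ψ x = _
  rw [hx, glueDeriv,
    piecewise_eq_of_notMem _ _ _ (Set.disjoint_right.1 (disjoint_islands hΛ) hxr)]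

/-- Green's formula for `d/dx` on the two islands. -/
theorem inner_derivMap_add_inner_derivMap (hΛ : 0 ≤ Λ) (ψ φ : AC1 Λ) {f g f' g' : ℝ → ℂ}
    (h : IsACRep Λ (ψ : L2 Λ) f g) (h' : IsACRep Λ (φ : L2 Λ) f' g') :
    ⟪derivMap Λ ψ, (φ : L2 Λ)⟫_ℂ + ⟪(ψ : L2 Λ), derivMap Λ φ⟫_ℂ
      = star (f (-Λ)) * f' (-Λ) - star (g Λ) * g' Λ := by
  rw [inner_eq_integral_add hΛ (derivMap_ae_left ψ h) (derivMap_ae_right hΛ ψ h) h'.ae_left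
      h'.ae_right, inner_eq_integral_add hΛ h.ae_left h.ae_right (derivMap_ae_left φ h')
      (derivMap_ae_right hΛ φ h')]
  have e1 := IsAC1On.integral_Iio_by_parts (a := -Λ) h.left h'.left
  have e2 := IsAC1On.integral_Ioi_by_parts (a := Λ) h.right h'.right
  rw [leftIsland, rightIsland, add_add_add_comm, e1, e2, sub_eq_add_neg]

theorem ae_eq_of_ae_islands {u v : L2 Λ}
    (hl : u =ᵐ[volume.restrict (leftIsland Λ)] v)
    (hr : u =ᵐ[volume.restrict (rightIsland Λ)] v) : u = v := by
  refine Lp.ext ?_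
  exact (ae_restrict_union_iff _ _ _).2 ⟨hl, hr⟩

/-- An element of `L²(Ω_Λ)` whose derivative, tested against `AC₀¹`, lies in `L²(Ω_Λ)` belongs to
`AC¹`. -/
theorem exists_derivMap_eq_of_weak_deriv (hΛ : 0 ≤ Λ) {u v : L2 Λ}
    (h : ∀ φ (hφ : φ ∈ AC10 Λ), ⟪u, derivMap Λ ⟨φ, AC10_le_AC1 Λ hφ⟩⟫_ℂ = -⟪v, φ⟫_ℂ) :
    ∃ hu : u ∈ AC1 Λ, derivMap Λ ⟨u, hu⟩ = v := by
  have huL := Lp.memLp u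
  have hvL := Lp.memLp v
  have hz := fun I => isAC1On_zero I
  have hd0 : deriv (0 : ℝ → ℂ) = 0 := by funext x; simp
  obtain ⟨f, hf, huf, hfv⟩ := exists_isAC1On_of_weak_deriv (I := leftIsland Λ)
    (p := fun n => -Λ - (n + 1)) (q := fun _ => -Λ) (u := u) (v := v)
    (measurableSet_leftIsland Λ)
    (fun i j hij => by
      have : (i : ℝ) ≤ j := Nat.cast_le.2 hij
      simp only; linarith)
    monotone_const (by simp) (by
      ext x
      simp only [mem_iUnion, mem_Ioo, exists_and_right, leftIsland, mem_Iio, and_iff_right_iff_imp]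
      intro _
      obtain ⟨n, hn⟩ := exists_nat_gt (-Λ - x)
      exact ⟨n, by linarith⟩)
    (huL.mono_measure (Measure.restrict_mono subset_union_left le_rfl))
    (hvL.mono_measure (Measure.restrict_mono subset_union_left le_rfl)) (by
      intro φ hφ hφ0
      obtain ⟨χ, hχ⟩ := exists_isACRep hΛ hφ (hz _)
      have hχ0 : χ ∈ AC10 Λ := ⟨φ, 0, hχ, hφ0 _ (by simp [leftIsland]), rfl⟩
      have := h χ hχ0
      rw [inner_eq_integral_add hΛ (EventuallyEq.refl _ u) (EventuallyEq.refl _ u)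
        (derivMap_ae_left ⟨χ, AC10_le_AC1 Λ hχ0⟩ hχ)
        (derivMap_ae_right hΛ ⟨χ, AC10_le_AC1 Λ hχ0⟩ hχ),
        inner_eq_integral_add hΛ (EventuallyEq.refl _ v) (EventuallyEq.refl _ v)
        hχ.ae_left hχ.ae_right, hd0] at this
      simpa using this)
  obtain ⟨g, hg, hug, hgv⟩ := exists_isAC1On_of_weak_deriv (I := rightIsland Λ)
    (p := fun _ => Λ) (q := fun n => Λ + (n + 1)) (u := u) (v := v)
    (measurableSet_rightIsland Λ) antitone_const
    (fun i j hij => by simpa using hij)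
    (by simp) (by
      ext x
      simp only [mem_iUnion, mem_Ioo, exists_and_left, rightIsland, mem_Ioi, and_iff_left_iff_imp]
      intro _
      obtain ⟨n, hn⟩ := exists_nat_gt (x - Λ)
      exact ⟨n, by linarith⟩)
    (huL.mono_measure (Measure.restrict_mono subset_union_right le_rfl))
    (hvL.mono_measure (Measure.restrict_mono subset_union_right le_rfl)) (by
      intro φ hφ hφ0
      obtain ⟨χ, hχ⟩ := exists_isACRep hΛ (hz _) hφ
      have hχ0 : χ ∈ AC10 Λ := ⟨0, φ, hχ, rfl, hφ0 _ (by simp [rightIsland])⟩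
      have := h χ hχ0
      rw [inner_eq_integral_add hΛ (EventuallyEq.refl _ u) (EventuallyEq.refl _ u)
        (derivMap_ae_left ⟨χ, AC10_le_AC1 Λ hχ0⟩ hχ)
        (derivMap_ae_right hΛ ⟨χ, AC10_le_AC1 Λ hχ0⟩ hχ),
        inner_eq_integral_add hΛ (EventuallyEq.refl _ v) (EventuallyEq.refl _ v)
        hχ.ae_left hχ.ae_right, hd0] at this
      simpa using this)
  have hrep : IsACRep Λ u f g := ⟨hf, hg, huf, hug⟩
  refine ⟨⟨f, g, hrep⟩, ae_eq_of_ae_islands ?_ ?_⟩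
  · exact (derivMap_ae_left ⟨u, _⟩ hrep).trans hfv
  · exact (derivMap_ae_right hΛ ⟨u, _⟩ hrep).trans hgv

/-- `AC₀¹` is dense: an element orthogonal to it is the weak derivative of `0`. -/
theorem eq_zero_of_orthogonal_AC10 (hΛ : 0 ≤ Λ) {v : L2 Λ} (h : ∀ φ ∈ AC10 Λ, ⟪v, φ⟫_ℂ = 0) :
    v = 0 := by
  obtain ⟨hu, he⟩ := exists_derivMap_eq_of_weak_deriv hΛ (u := 0) (v := v)
    fun φ hφ => by rw [inner_zero_left, h φ hφ, neg_zero]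
  rw [← he]
  exact map_zero (derivMap Λ)

end Scalar

/-! ### Boundary values -/

section Boundary

variable {Λ : ℝ}

theorem isAC1On_of_contDiff {f : ℝ → ℂ} (hf : ContDiff ℝ 1 f) (hc : HasCompactSupport f)
    (I : Set ℝ) : IsAC1On I f where
  memLp := (hf.continuous.memLp_of_hasCompactSupport hc).restrict I
  ac _ _ _ _ := hf.contDiffOn.absolutelyContinuousOnInterval
  memLp_deriv :=
    ((hf.continuous_deriv le_rfl).memLp_of_hasCompactSupport hc.deriv).restrict I

/-- An `AC¹` function with a prescribed value at `a`: a multiple of a smooth bump at `a`. -/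
theorem exists_isAC1On_eq (I : Set ℝ) (a : ℝ) (c : ℂ) : ∃ f, IsAC1On I f ∧ f a = c := by
  let b : ContDiffBump a := ⟨1, 2, one_pos, one_lt_two⟩
  have hb : IsAC1On I fun x => ((b x : ℝ) : ℂ) :=
    isAC1On_of_contDiff (Complex.ofRealCLM.contDiff.comp b.contDiff)
      (b.hasCompactSupport.comp_left Complex.ofReal_zero) I
  refine ⟨_, hb.smul c, ?_⟩
  have : b a = 1 := b.one_of_mem_closedBall (by simp [b])
  simp [this]

/-- The boundary values can be prescribed freely. -/
theorem exists_hasBoundaryValues (hΛ : 0 ≤ Λ) (v w : Fin 2 → ℂ) :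
    ∃ ψ : Spinor Λ, HasBoundaryValues ψ v w := by
  obtain ⟨f, hf, hfv⟩ := exists_isAC1On_eq (leftIsland Λ) (-Λ) (v 0)
  obtain ⟨g, hg, hgw⟩ := exists_isAC1On_eq (rightIsland Λ) Λ (w 0)
  obtain ⟨k, hk, hkv⟩ := exists_isAC1On_eq (leftIsland Λ) (-Λ) (v 1)
  obtain ⟨l, hl, hlw⟩ := exists_isAC1On_eq (rightIsland Λ) Λ (w 1)
  obtain ⟨ψ, hψ⟩ := exists_isACRep hΛ hf hg
  obtain ⟨χ, hχ⟩ := exists_isACRep hΛ hk hl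
  refine ⟨WithLp.toLp 2 (ψ, χ), f, g, k, l, hψ, hχ, ?_, ?_⟩
  · ext i; fin_cases i <;> simp [hfv, hkv]
  · ext i; fin_cases i <;> simp [hgw, hlw]

theorem IsACRep.boundary_unique {ψ : L2 Λ} {f g f' g' : ℝ → ℂ} (h : IsACRep Λ ψ f g)
    (h' : IsACRep Λ ψ f' g') : f (-Λ) = f' (-Λ) ∧ g Λ = g' Λ := by
  obtain ⟨hl, hr⟩ := h.unique h'
  constructor
  · have hlt : -Λ - 1 < -Λ := by linarith
    have m1 : -Λ - 1 ∈ closure (leftIsland Λ) := by simp [leftIsland]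
    have m2 : -Λ ∈ closure (leftIsland Λ) := by simp [leftIsland]
    have c1 := (h.left.ac _ m1 _ m2).continuousOn
    have c2 := (h'.left.ac _ m1 _ m2).continuousOn
    rw [uIcc_of_le hlt.le] at c1 c2
    exact (hl.mono fun x hx => hx.2 : EqOn f f' (Ioo (-Λ - 1) (-Λ))).of_subset_closure c1 c2
      Ioo_subset_Icc_self (closure_Ioo hlt.ne).ge (right_mem_Icc.2 hlt.le)
  · have hlt : Λ < Λ + 1 := by linarith
    have m1 : Λ + 1 ∈ closure (rightIsland Λ) := by simp [rightIsland]
    have m2 : Λ ∈ closure (rightIsland Λ) := by simp [rightIsland]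
    have c1 := (h.right.ac _ m2 _ m1).continuousOn
    have c2 := (h'.right.ac _ m2 _ m1).continuousOn
    rw [uIcc_of_le hlt.le] at c1 c2
    exact (hr.mono fun x hx => hx.1 : EqOn g g' (Ioo Λ (Λ + 1))).of_subset_closure c1 c2
      Ioo_subset_Icc_self (closure_Ioo hlt.ne).ge (left_mem_Icc.2 hlt.le)

theorem HasBoundaryValues.unique {ψ : Spinor Λ} {v w v' w' : Fin 2 → ℂ}
    (h : HasBoundaryValues ψ v w) (h' : HasBoundaryValues ψ v' w') : v = v' ∧ w = w' := by
  obtain ⟨f, g, k, l, h1, h2, rfl, rfl⟩ := h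
  obtain ⟨f', g', k', l', h1', h2', rfl, rfl⟩ := h'
  obtain ⟨e1, e2⟩ := h1.boundary_unique h1'
  obtain ⟨e3, e4⟩ := h2.boundary_unique h2'
  exact ⟨by rw [e1, e3], by rw [e2, e4]⟩

theorem HasBoundaryValues.add {ψ φ : Spinor Λ} {v w v' w' : Fin 2 → ℂ}
    (h : HasBoundaryValues ψ v w) (h' : HasBoundaryValues φ v' w') :
    HasBoundaryValues (ψ + φ) (v + v') (w + w') := by
  obtain ⟨f, g, k, l, h1, h2, rfl, rfl⟩ := h
  obtain ⟨f', g', k', l', h1', h2', rfl, rfl⟩ := h'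
  exact ⟨_, _, _, _, h1.add h1', h2.add h2', by simp, by simp⟩

theorem HasBoundaryValues.smul (c : ℂ) {ψ : Spinor Λ} {v w : Fin 2 → ℂ}
    (h : HasBoundaryValues ψ v w) : HasBoundaryValues (c • ψ) (c • v) (c • w) := by
  obtain ⟨f, g, k, l, h1, h2, rfl, rfl⟩ := h
  exact ⟨_, _, _, _, h1.smul c, h2.smul c, by simp, by simp⟩

theorem HasBoundaryValues.sub {ψ φ : Spinor Λ} {v w v' w' : Fin 2 → ℂ}
    (h : HasBoundaryValues ψ v w) (h' : HasBoundaryValues φ v' w') :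
    HasBoundaryValues (ψ - φ) (v - v') (w - w') := by
  simpa only [neg_one_smul, ← sub_eq_add_neg] using h.add (h'.smul (-1))

theorem HasBoundaryValues.mem_AC1 {ψ : Spinor Λ} {v w : Fin 2 → ℂ}
    (h : HasBoundaryValues ψ v w) : ψ.fst ∈ AC1 Λ ∧ ψ.snd ∈ AC1 Λ := by
  obtain ⟨f, g, k, l, h1, h2, -, -⟩ := h
  exact ⟨⟨f, g, h1⟩, ⟨k, l, h2⟩⟩

theorem exists_hasBoundaryValues_of_mem_AC1 {ψ : Spinor Λ} (h1 : ψ.fst ∈ AC1 Λ)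
    (h2 : ψ.snd ∈ AC1 Λ) : ∃ v w, HasBoundaryValues ψ v w := by
  obtain ⟨f, g, h1⟩ := h1
  obtain ⟨k, l, h2⟩ := h2
  exact ⟨_, _, f, g, k, l, h1, h2, rfl, rfl⟩

/-- The domain of `H₀` is the kernel of the boundary values on the domain of `H₀*`. -/
theorem mem_minimalDirac_domain_iff (m : ℝ) {ψ : Spinor Λ} :
    ψ ∈ (minimalDirac m Λ).domain ↔ HasBoundaryValues ψ 0 0 := by
  constructor
  · rintro ⟨⟨f, g, h1, hf, hg⟩, ⟨k, l, h2, hk, hl⟩⟩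
    exact ⟨f, g, k, l, h1, h2, by rw [hf, hk]; ext i; fin_cases i <;> rfl,
      by rw [hg, hl]; ext i; fin_cases i <;> rfl⟩
  · rintro ⟨f, g, k, l, h1, h2, hv, hw⟩
    have e1 := congrFun hv 0
    have e2 := congrFun hv 1
    have e3 := congrFun hw 0
    have e4 := congrFun hw 1
    simp only [Pi.zero_apply, Matrix.cons_val_zero, Matrix.cons_val_one] at e1 e2 e3 e4
    exact ⟨⟨f, g, h1, e1.symm, e3.symm⟩, ⟨k, l, h2, e2.symm, e4.symm⟩⟩

end Boundary

/-! ### The adjoint of the minimal Dirac operator -/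

section Operator

variable {Λ : ℝ}

theorem inner_spinor (ψ φ : Spinor Λ) :
    ⟪ψ, φ⟫_ℂ = ⟪ψ.fst, φ.fst⟫_ℂ + ⟪ψ.snd, φ.snd⟫_ℂ := rfl

/-- The Dirac operation `(-i ψ↓' + m ψ↑, -i ψ↑' - m ψ↓)` on a spinor with `AC¹` components. -/
def diracOp (m : ℝ) (ψ : Spinor Λ) (h₁ : ψ.fst ∈ AC1 Λ) (h₂ : ψ.snd ∈ AC1 Λ) : Spinor Λ :=
  WithLp.toLp 2 ((-Complex.I) • derivMap Λ ⟨ψ.snd, h₂⟩ + (m : ℂ) • ψ.fst,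
    (-Complex.I) • derivMap Λ ⟨ψ.fst, h₁⟩ - (m : ℂ) • ψ.snd)

theorem minimalDirac_apply (m : ℝ) (ψ : (minimalDirac m Λ).domain) :
    minimalDirac m Λ ψ
      = diracOp m (ψ : Spinor Λ) (AC10_le_AC1 Λ ψ.2.1) (AC10_le_AC1 Λ ψ.2.2) :=
  rfl

/-- The boundary form on the pairs `(ψ(-Λ), ψ(+Λ))`: the difference of the form `⟨σₓ v, v'⟩` at
`-Λ` and at `+Λ`. -/
def boundaryForm (x y : (Fin 2 → ℂ) × (Fin 2 → ℂ)) : ℂ :=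
  star (x.1 1) * y.1 0 + star (x.1 0) * y.1 1 - (star (x.2 1) * y.2 0 + star (x.2 0) * y.2 1)

/-- Green's formula for the Dirac operation; the mass terms cancel because `m` is real. -/
theorem inner_diracOp_sub_inner_diracOp (hΛ : 0 ≤ Λ) (m : ℝ) {ψ φ : Spinor Λ}
    {v w v' w' : Fin 2 → ℂ} (h : HasBoundaryValues ψ v w) (h' : HasBoundaryValues φ v' w')
    (h₁ : ψ.fst ∈ AC1 Λ) (h₂ : ψ.snd ∈ AC1 Λ) (h₁' : φ.fst ∈ AC1 Λ) (h₂' : φ.snd ∈ AC1 Λ) :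
    ⟪diracOp m ψ h₁ h₂, φ⟫_ℂ - ⟪ψ, diracOp m φ h₁' h₂'⟫_ℂ
      = Complex.I * boundaryForm (v, w) (v', w') := by
  obtain ⟨f, g, k, l, r1, r2, rfl, rfl⟩ := h
  obtain ⟨f', g', k', l', r1', r2', rfl, rfl⟩ := h'
  have e1 := inner_derivMap_add_inner_derivMap hΛ ⟨ψ.snd, h₂⟩ ⟨φ.fst, h₁'⟩ r2 r1'
  have e2 := inner_derivMap_add_inner_derivMap hΛ ⟨ψ.fst, h₁⟩ ⟨φ.snd, h₂'⟩ r1 r2'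
  simp only [diracOp, inner_spinor, WithLp.toLp_fst, WithLp.toLp_snd, inner_add_left,
    inner_add_right, inner_sub_left, inner_sub_right, inner_smul_left, inner_smul_right, map_neg,
    Complex.conj_I, Complex.conj_ofReal, boundaryForm, Matrix.cons_val_zero,
    Matrix.cons_val_one]
  linear_combination Complex.I * e1 + Complex.I * e2

theorem dense_minimalDirac_domain (hΛ : 0 ≤ Λ) (m : ℝ) :
    Dense ((minimalDirac m Λ).domain : Set (Spinor Λ)) := by
  rw [Submodule.dense_iff_topologicalClosure_eq_top, Submodule.topologicalClosure_eq_top_iff,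
    Submodule.eq_bot_iff]
  intro ψ hψ
  rw [Submodule.mem_orthogonal'] at hψ
  have h1 : ψ.fst = 0 := eq_zero_of_orthogonal_AC10 hΛ fun φ hφ => by
    simpa [inner_spinor] using
      hψ (WithLp.toLp 2 (φ, 0)) ⟨hφ, zero_mem _⟩
  have h2 : ψ.snd = 0 := eq_zero_of_orthogonal_AC10 hΛ fun φ hφ => by
    simpa [inner_spinor] using
      hψ (WithLp.toLp 2 (0, φ)) ⟨zero_mem _, hφ⟩
  exact WithLp.ofLp_injective 2 (Prod.ext h1 h2)

/-- An adjoint pair of the minimal operator has `AC¹` components and is related by the Dirac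
operation: testing with the spinors `(φ, 0)` and `(0, φ)` gives the weak derivatives of the two
components. -/
theorem eq_diracOp_of_forall_inner (hΛ : 0 ≤ Λ) {m : ℝ} {ψ χ : Spinor Λ}
    (h : ∀ φ : (minimalDirac m Λ).domain, ⟪χ, (φ : Spinor Λ)⟫_ℂ = ⟪ψ, minimalDirac m Λ φ⟫_ℂ) :
    ∃ (h₁ : ψ.fst ∈ AC1 Λ) (h₂ : ψ.snd ∈ AC1 Λ), χ = diracOp m ψ h₁ h₂ := by
  have hzero : ∀ hz : (0 : L2 Λ) ∈ AC1 Λ, derivMap Λ ⟨0, hz⟩ = 0 :=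
    fun hz => map_zero (derivMap Λ)
  obtain ⟨h₂, e₂⟩ := exists_derivMap_eq_of_weak_deriv hΛ (u := ψ.snd)
    (v := Complex.I • (χ.fst - (m : ℂ) • ψ.fst)) fun φ hφ => by
      have := h ⟨WithLp.toLp 2 (φ, 0), hφ, zero_mem _⟩
      simp only [minimalDirac_apply, diracOp, inner_spinor, WithLp.toLp_fst,
        WithLp.toLp_snd, hzero, smul_zero, zero_add, sub_zero, inner_zero_right, add_zero,
        inner_smul_right] at this
      simp only [inner_smul_left, inner_sub_left, Complex.conj_I, Complex.conj_ofReal]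
      linear_combination (-Complex.I) * this + (⟪ψ.snd, derivMap Λ ⟨φ, AC10_le_AC1 Λ hφ⟩⟫_ℂ) * Complex.I_sq
  obtain ⟨h₁, e₁⟩ := exists_derivMap_eq_of_weak_deriv hΛ (u := ψ.fst)
    (v := Complex.I • (χ.snd + (m : ℂ) • ψ.snd)) fun φ hφ => by
      have := h ⟨WithLp.toLp 2 (0, φ), zero_mem _, hφ⟩
      simp only [minimalDirac_apply, diracOp, inner_spinor, WithLp.toLp_fst,
        WithLp.toLp_snd, hzero, smul_zero, zero_sub, add_zero, inner_zero_right, zero_add,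
        inner_smul_right, inner_neg_right] at this
      simp only [inner_smul_left, inner_add_left, Complex.conj_I, Complex.conj_ofReal]
      linear_combination (-Complex.I) * this + (⟪ψ.fst, derivMap Λ ⟨φ, AC10_le_AC1 Λ hφ⟩⟫_ℂ) * Complex.I_sq
  refine ⟨h₁, h₂, WithLp.ofLp_injective 2 (Prod.ext ?_ ?_)⟩
  · change χ.fst = (-Complex.I) • derivMap Λ ⟨ψ.snd, h₂⟩ + (m : ℂ) • ψ.fst
    rw [e₂, smul_smul, neg_mul, Complex.I_mul_I, neg_neg, one_smul, sub_add_cancel]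
  · change χ.snd = (-Complex.I) • derivMap Λ ⟨ψ.fst, h₁⟩ - (m : ℂ) • ψ.snd
    rw [e₁, smul_smul, neg_mul, Complex.I_mul_I, neg_neg, one_smul, add_sub_cancel_right]

theorem inner_diracOp_minimalDirac (hΛ : 0 ≤ Λ) (m : ℝ) {ψ : Spinor Λ}
    (h₁ : ψ.fst ∈ AC1 Λ) (h₂ : ψ.snd ∈ AC1 Λ) (φ : (minimalDirac m Λ).domain) :
    ⟪diracOp m ψ h₁ h₂, (φ : Spinor Λ)⟫_ℂ = ⟪ψ, minimalDirac m Λ φ⟫_ℂ := by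
  obtain ⟨v, w, hvw⟩ := exists_hasBoundaryValues_of_mem_AC1 h₁ h₂
  have := inner_diracOp_sub_inner_diracOp hΛ m hvw ((mem_minimalDirac_domain_iff m).1 φ.2) h₁ h₂
    (AC10_le_AC1 Λ φ.2.1) (AC10_le_AC1 Λ φ.2.2)
  rw [minimalDirac_apply, ← sub_eq_zero, this]
  simp [boundaryForm]

theorem mem_maximalDirac_domain_iff (hΛ : 0 ≤ Λ) (m : ℝ) {ψ : Spinor Λ} :
    ψ ∈ (maximalDirac m Λ).domain ↔ ∃ v w, HasBoundaryValues ψ v w := by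
  constructor
  · intro h
    obtain ⟨h₁, h₂, -⟩ := eq_diracOp_of_forall_inner hΛ (χ := maximalDirac m Λ ⟨ψ, h⟩)
      fun φ => LinearPMap.adjoint_isFormalAdjoint (dense_minimalDirac_domain hΛ m) ⟨ψ, h⟩ φ
    exact exists_hasBoundaryValues_of_mem_AC1 h₁ h₂
  · rintro ⟨v, w, h⟩
    obtain ⟨h₁, h₂⟩ := h.mem_AC1
    exact LinearPMap.mem_adjoint_domain_of_exists _
      ⟨diracOp m ψ h₁ h₂, inner_diracOp_minimalDirac hΛ m h₁ h₂⟩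

theorem maximalDirac_apply (hΛ : 0 ≤ Λ) (m : ℝ) (ψ : (maximalDirac m Λ).domain)
    (h₁ : (ψ : Spinor Λ).fst ∈ AC1 Λ) (h₂ : (ψ : Spinor Λ).snd ∈ AC1 Λ) :
    maximalDirac m Λ ψ = diracOp m (ψ : Spinor Λ) h₁ h₂ :=
  LinearPMap.adjoint_apply_eq (dense_minimalDirac_domain hΛ m) ψ
    (inner_diracOp_minimalDirac hΛ m h₁ h₂)

theorem inner_maximalDirac_sub (hΛ : 0 ≤ Λ) (m : ℝ) (ψ φ : (maximalDirac m Λ).domain)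
    {v w v' w' : Fin 2 → ℂ} (h : HasBoundaryValues (ψ : Spinor Λ) v w)
    (h' : HasBoundaryValues (φ : Spinor Λ) v' w') :
    ⟪maximalDirac m Λ ψ, (φ : Spinor Λ)⟫_ℂ - ⟪(ψ : Spinor Λ), maximalDirac m Λ φ⟫_ℂ
      = Complex.I * boundaryForm (v, w) (v', w') := by
  rw [maximalDirac_apply hΛ m ψ h.mem_AC1.1 h.mem_AC1.2,
    maximalDirac_apply hΛ m φ h'.mem_AC1.1 h'.mem_AC1.2]
  exact inner_diracOp_sub_inner_diracOp hΛ m h h' _ _ _ _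

theorem minimalDirac_le_maximalDirac (hΛ : 0 ≤ Λ) (m : ℝ) :
    minimalDirac m Λ ≤ maximalDirac m Λ := by
  refine ⟨fun ψ h => (mem_maximalDirac_domain_iff hΛ m).2
    ⟨0, 0, (mem_minimalDirac_domain_iff m).1 h⟩, fun ψ φ hψφ => ?_⟩
  have h1 := AC10_le_AC1 Λ ψ.2.1
  have h2 := AC10_le_AC1 Λ ψ.2.2
  obtain ⟨φ, hφ⟩ := φ
  obtain rfl : (ψ : Spinor Λ) = φ := hψφ
  rw [maximalDirac_apply hΛ m ⟨ψ, hφ⟩ h1 h2, minimalDirac_apply]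

end Operator

/-! ### Self-adjoint extensions and Lagrangian subspaces -/

section Extension

variable {Λ : ℝ}

/-- A subspace of boundary values is Lagrangian if it is its own orthogonal complement for the
boundary form. -/
def IsLagrangian (C : Submodule ℂ ((Fin 2 → ℂ) × (Fin 2 → ℂ))) : Prop :=
  ∀ x, x ∈ C ↔ ∀ y ∈ C, boundaryForm y x = 0

/-- The restriction of `H₀*` by the linear boundary condition `C`. -/
def diracBC (m Λ : ℝ) (C : Submodule ℂ ((Fin 2 → ℂ) × (Fin 2 → ℂ))) :
    Spinor Λ →ₗ.[ℂ] Spinor Λ :=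
  (maximalDirac m Λ).domRestrict (bcSpace Λ C)

theorem mem_diracBC_domain_iff (hΛ : 0 ≤ Λ) (m : ℝ)
    {C : Submodule ℂ ((Fin 2 → ℂ) × (Fin 2 → ℂ))} {ψ : Spinor Λ} :
    ψ ∈ (diracBC m Λ C).domain ↔ ∃ v w, HasBoundaryValues ψ v w ∧ (v, w) ∈ C := by
  refine ⟨fun h => h.1, fun h => ⟨h, ?_⟩⟩
  obtain ⟨v, w, hvw, -⟩ := h
  exact (mem_maximalDirac_domain_iff hΛ m).2 ⟨v, w, hvw⟩

/-- The boundary condition is recovered from the domain, since all boundary values occur. -/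
theorem diracBC_injective (hΛ : 0 ≤ Λ) (m : ℝ)
    {C C' : Submodule ℂ ((Fin 2 → ℂ) × (Fin 2 → ℂ))} (h : diracBC m Λ C = diracBC m Λ C') :
    C = C' := by
  have key : ∀ {C C' : Submodule ℂ ((Fin 2 → ℂ) × (Fin 2 → ℂ))},
      diracBC m Λ C = diracBC m Λ C' → C ≤ C' := by
    rintro C C' h ⟨v, w⟩ hvw
    obtain ⟨ψ, hψ⟩ := exists_hasBoundaryValues hΛ v w
    have h1 : ψ ∈ (diracBC m Λ C).domain := (mem_diracBC_domain_iff hΛ m).2 ⟨v, w, hψ, hvw⟩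
    rw [h, mem_diracBC_domain_iff hΛ m] at h1
    obtain ⟨v', w', hψ', hmem⟩ := h1
    obtain ⟨rfl, rfl⟩ := hψ.unique hψ'
    exact hmem
  exact le_antisymm (key h) (key h.symm)

theorem minimalDirac_le_diracBC (hΛ : 0 ≤ Λ) (m : ℝ)
    (C : Submodule ℂ ((Fin 2 → ℂ) × (Fin 2 → ℂ))) : minimalDirac m Λ ≤ diracBC m Λ C := by
  refine ⟨fun ψ h => (mem_diracBC_domain_iff hΛ m).2
    ⟨0, 0, (mem_minimalDirac_domain_iff m).1 h, C.zero_mem⟩, fun ψ φ hψφ => ?_⟩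
  have hle := minimalDirac_le_maximalDirac hΛ m
  rw [hle.2 (y := ⟨ψ, hle.1 ψ.2⟩) rfl]
  exact (LinearPMap.domRestrict_apply hψφ.symm).symm

theorem isSelfAdjointExtension_diracBC (hΛ : 0 ≤ Λ) (m : ℝ)
    {C : Submodule ℂ ((Fin 2 → ℂ) × (Fin 2 → ℂ))} (hC : IsLagrangian C) :
    IsSelfAdjointExtension (minimalDirac m Λ) (diracBC m Λ C) := by
  have hmin := minimalDirac_le_diracBC hΛ m C
  have hdense : Dense ((diracBC m Λ C).domain : Set (Spinor Λ)) :=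
    (dense_minimalDirac_domain hΛ m).mono hmin.1
  have hval : ∀ (φ : (diracBC m Λ C).domain), diracBC m Λ C φ = maximalDirac m Λ ⟨φ, φ.2.2⟩ :=
    fun φ => LinearPMap.domRestrict_apply rfl
  refine ⟨hmin, LinearPMap.isSelfAdjoint_def.2 (Eq.symm ?_)⟩
  have hle : diracBC m Λ C ≤ (diracBC m Λ C).adjoint := by
    refine LinearPMap.IsFormalAdjoint.le_adjoint hdense fun ψ φ => ?_
    obtain ⟨v, w, h, hmem⟩ := (mem_diracBC_domain_iff hΛ m).1 ψ.2
    obtain ⟨v', w', h', hmem'⟩ := (mem_diracBC_domain_iff hΛ m).1 φ.2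
    have := inner_maximalDirac_sub hΛ m ⟨ψ, ψ.2.2⟩ ⟨φ, φ.2.2⟩ h h'
    rw [(hC _).1 hmem' _ hmem, mul_zero, sub_eq_zero] at this
    rw [hval, hval, this]
  refine LinearPMap.eq_of_le_of_domain_eq hle (le_antisymm hle.1 fun ψ hψ => ?_)
  have hadj := LinearPMap.adjoint_isFormalAdjoint hdense ⟨ψ, hψ⟩
  -- The adjoint of an extension of `H₀` is a restriction of `H₀*`.
  have hmax : ψ ∈ (maximalDirac m Λ).domain :=
    LinearPMap.mem_adjoint_domain_of_exists _ ⟨(diracBC m Λ C).adjoint ⟨ψ, hψ⟩, fun φ => by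
      rw [hmin.2 (y := ⟨φ, hmin.1 φ.2⟩) rfl]
      exact hadj ⟨φ, hmin.1 φ.2⟩⟩
  have hmaxval : maximalDirac m Λ ⟨ψ, hmax⟩ = (diracBC m Λ C).adjoint ⟨ψ, hψ⟩ :=
    LinearPMap.adjoint_apply_eq (dense_minimalDirac_domain hΛ m) _ fun φ => by
      rw [hmin.2 (y := ⟨φ, hmin.1 φ.2⟩) rfl]
      exact hadj ⟨φ, hmin.1 φ.2⟩
  obtain ⟨v, w, hvw⟩ := (mem_maximalDirac_domain_iff hΛ m).1 hmax
  refine (mem_diracBC_domain_iff hΛ m).2 ⟨v, w, hvw, (hC _).2 ?_⟩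
  -- Green's formula for `ψ` and the elements `φ` of the domain; their boundary values fill `C`.
  rintro ⟨v', w'⟩ hmem'
  obtain ⟨φ, hφ⟩ := exists_hasBoundaryValues hΛ v' w'
  have hφd : φ ∈ (diracBC m Λ C).domain := (mem_diracBC_domain_iff hΛ m).2 ⟨v', w', hφ, hmem'⟩
  have h1 := hadj ⟨φ, hφd⟩
  rw [← hmaxval, hval] at h1
  have h2 := inner_maximalDirac_sub hΛ m ⟨φ, hφd.2⟩ ⟨ψ, hmax⟩ hφ hvw
  have h3 := congrArg (starRingEnd ℂ) h1
  rw [inner_conj_symm, inner_conj_symm] at h3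
  rw [← h3] at h2
  simpa using h2.symm

/-- `C` is the space of boundary values of the domain of `H`. -/
theorem exists_isLagrangian_of_isSelfAdjointExtension (hΛ : 0 ≤ Λ) (m : ℝ)
    {H : Spinor Λ →ₗ.[ℂ] Spinor Λ} (hH : IsSelfAdjointExtension (minimalDirac m Λ) H) :
    ∃ C, IsLagrangian C ∧ H = diracBC m Λ C := by
  obtain ⟨hmin, hsa⟩ := hH
  have hdense := hsa.dense_domain
  rw [LinearPMap.isSelfAdjoint_def] at hsa
  have hsymm : ∀ ψ φ : H.domain, ⟪H ψ, (φ : Spinor Λ)⟫_ℂ = ⟪(ψ : Spinor Λ), H φ⟫_ℂ := by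
    have := LinearPMap.adjoint_isFormalAdjoint hdense
    rwa [hsa] at this
  have hle : H ≤ maximalDirac m Λ :=
    LinearPMap.IsFormalAdjoint.le_adjoint (dense_minimalDirac_domain hΛ m) fun φ ψ => by
      rw [hmin.2 (y := ⟨φ, hmin.1 φ.2⟩) rfl]
      exact hsymm ⟨φ, hmin.1 φ.2⟩ ψ
  have hform : ∀ (ψ : (maximalDirac m Λ).domain) (φ : H.domain) {v w v' w' : Fin 2 → ℂ},
      HasBoundaryValues (ψ : Spinor Λ) v w → HasBoundaryValues (φ : Spinor Λ) v' w' →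
      ⟪H φ, (ψ : Spinor Λ)⟫_ℂ - ⟪(φ : Spinor Λ), maximalDirac m Λ ψ⟫_ℂ
        = Complex.I * boundaryForm (v', w') (v, w) := fun ψ φ v w v' w' h h' => by
    rw [hle.2 (y := ⟨φ, hle.1 φ.2⟩) rfl]
    exact inner_maximalDirac_sub hΛ m ⟨φ, hle.1 φ.2⟩ ψ h' h
  let C : Submodule ℂ ((Fin 2 → ℂ) × (Fin 2 → ℂ)) :=
    { carrier := {x | ∃ ψ ∈ H.domain, HasBoundaryValues ψ x.1 x.2}
      add_mem' := fun ⟨ψ, h, hv⟩ ⟨φ, h', hv'⟩ => ⟨ψ + φ, add_mem h h', hv.add hv'⟩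
      zero_mem' := ⟨0, zero_mem _, (mem_minimalDirac_domain_iff m).1 (zero_mem _)⟩
      smul_mem' := fun c _ ⟨ψ, h, hv⟩ => ⟨c • ψ, Submodule.smul_mem _ c h, hv.smul c⟩ }
  -- Membership in `D(H)` depends on the boundary values only, as `D(H₀) ⊆ D(H)`.
  have hCmem : ∀ {ψ : Spinor Λ} {v w : Fin 2 → ℂ}, HasBoundaryValues ψ v w → (v, w) ∈ C →
      ψ ∈ H.domain := by
    rintro ψ v w hψ ⟨φ, hφ, hφv⟩
    have h0 : ψ - φ ∈ (minimalDirac m Λ).domain := by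
      rw [mem_minimalDirac_domain_iff]
      simpa using hψ.sub hφv
    simpa using add_mem (hmin.1 h0) hφ
  refine ⟨C, ?_, ?_⟩
  · rintro ⟨v, w⟩
    constructor
    · rintro ⟨ψ, hψ, hψv⟩ ⟨v', w'⟩ ⟨φ, hφ, hφv⟩
      have := hform ⟨ψ, hle.1 hψ⟩ ⟨φ, hφ⟩ hψv hφv
      rw [← hle.2 (x := ⟨ψ, hψ⟩) rfl, hsymm ⟨φ, hφ⟩ ⟨ψ, hψ⟩, sub_self] at this
      simpa using this.symm
    · intro h
      obtain ⟨ψ, hψ⟩ := exists_hasBoundaryValues hΛ v w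
      have hmax : ψ ∈ (maximalDirac m Λ).domain := (mem_maximalDirac_domain_iff hΛ m).2 ⟨v, w, hψ⟩
      refine ⟨ψ, ?_, hψ⟩
      rw [← hsa]
      refine LinearPMap.mem_adjoint_domain_of_exists _ ⟨maximalDirac m Λ ⟨ψ, hmax⟩, fun φ => ?_⟩
      obtain ⟨v', w', hφ⟩ := (mem_maximalDirac_domain_iff hΛ m).1 (hle.1 φ.2)
      have := hform ⟨ψ, hmax⟩ φ hψ hφ
      rw [h _ ⟨φ, φ.2, hφ⟩, mul_zero, sub_eq_zero] at this
      have h3 := congrArg (starRingEnd ℂ) this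
      rw [inner_conj_symm, inner_conj_symm] at h3
      exact h3.symm
  · have hdom : H.domain = (diracBC m Λ C).domain := by
      ext ψ
      rw [mem_diracBC_domain_iff hΛ m]
      constructor
      · intro h
        obtain ⟨v, w, hvw⟩ := (mem_maximalDirac_domain_iff hΛ m).1 (hle.1 h)
        exact ⟨v, w, hvw, ψ, h, hvw⟩
      · rintro ⟨v, w, hvw, hmem⟩
        exact hCmem hvw hmem
    refine LinearPMap.eq_of_le_of_domain_eq ⟨hdom.le, fun ψ φ hψφ => ?_⟩ hdom
    rw [hle.2 (y := ⟨ψ, hle.1 ψ.2⟩) rfl]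
    exact (LinearPMap.domRestrict_apply hψφ.symm).symm

theorem isSelfAdjointExtension_iff (hΛ : 0 ≤ Λ) (m : ℝ) {H : Spinor Λ →ₗ.[ℂ] Spinor Λ} :
    IsSelfAdjointExtension (minimalDirac m Λ) H ↔ ∃ C, IsLagrangian C ∧ H = diracBC m Λ C := by
  refine ⟨exists_isLagrangian_of_isSelfAdjointExtension hΛ m, ?_⟩
  rintro ⟨C, hC, rfl⟩
  exact isSelfAdjointExtension_diracBC hΛ m hC

end Extension

/-! ### Classification of the Lagrangian subspaces -/

section Classification

/-- The form `⟨σₓ u, v⟩` on the values at one boundary point. -/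
def sigmaForm (u v : Fin 2 → ℂ) : ℂ := star (u 1) * v 0 + star (u 0) * v 1

theorem boundaryForm_eq (x y : (Fin 2 → ℂ) × (Fin 2 → ℂ)) :
    boundaryForm x y = sigmaForm x.1 y.1 - sigmaForm x.2 y.2 := rfl

@[simp] theorem sigmaForm_zero_left (v : Fin 2 → ℂ) : sigmaForm 0 v = 0 := by simp [sigmaForm]

@[simp] theorem sigmaForm_zero_right (v : Fin 2 → ℂ) : sigmaForm v 0 = 0 := by simp [sigmaForm]

theorem sigmaForm_smul_left (c : ℂ) (u v : Fin 2 → ℂ) :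
    sigmaForm (c • u) v = star c * sigmaForm u v := by
  simp only [sigmaForm, Pi.smul_apply, smul_eq_mul, star_mul]; ring

/-- A vector spanning the line described by `EdgeCondition r`. -/
def edgeVector : WithTop ℝ → Fin 2 → ℂ
  | ⊤ => ![0, 1]
  | (t : ℝ) => ![1, Complex.I * (t : ℂ)]

theorem edgeVector_ne_zero (r : WithTop ℝ) : edgeVector r ≠ 0 := by
  intro h
  cases r with
  | top => simpa [edgeVector] using congrFun h 1
  | coe t => simpa [edgeVector] using congrFun h 0

theorem edgeCondition_top_iff {u : Fin 2 → ℂ} : EdgeCondition ⊤ u ↔ u 0 = 0 := by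
  simp [EdgeCondition]

theorem edgeCondition_coe_iff {t : ℝ} {u : Fin 2 → ℂ} :
    EdgeCondition (t : WithTop ℝ) u ↔ Complex.I * (t : ℂ) * u 0 = u 1 := by
  simp only [EdgeCondition, WithTop.coe_inj, WithTop.coe_ne_top, false_imp_iff, and_true]
  exact ⟨fun h => h t rfl, fun h s hs => hs ▸ h⟩

theorem edgeCondition_iff_exists_smul {r : WithTop ℝ} {u : Fin 2 → ℂ} :
    EdgeCondition r u ↔ ∃ c : ℂ, u = c • edgeVector r := by
  cases r with
  | top =>
    rw [edgeCondition_top_iff]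
    constructor
    · intro h
      refine ⟨u 1, ?_⟩
      ext i; fin_cases i <;> simp [edgeVector, h]
    · rintro ⟨c, rfl⟩
      simp [edgeVector]
  | coe t =>
    rw [edgeCondition_coe_iff]
    constructor
    · intro h
      refine ⟨u 0, ?_⟩
      ext i; fin_cases i
      · simp [edgeVector]
      · simp [edgeVector, ← h, mul_comm]
    · rintro ⟨c, rfl⟩
      simp [edgeVector, mul_comm]

/-- Each edge line is its own orthogonal complement for `sigmaForm`. -/
theorem edgeCondition_iff_sigmaForm {r : WithTop ℝ} {u : Fin 2 → ℂ} :
    EdgeCondition r u ↔ sigmaForm (edgeVector r) u = 0 := by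
  cases r with
  | top => simp [edgeCondition_top_iff, sigmaForm, edgeVector]
  | coe t =>
    rw [edgeCondition_coe_iff, ← sub_eq_zero, ← neg_eq_zero]
    simp only [sigmaForm, edgeVector, Matrix.cons_val_zero, Matrix.cons_val_one, star_mul,
      star_one, one_mul, RCLike.star_def, Complex.conj_I, Complex.conj_ofReal]
    rw [show -(Complex.I * (t : ℂ) * u 0 - u 1) = (t : ℂ) * -Complex.I * u 0 + u 1 by ring]

/-- The isotropic lines of `sigmaForm` are the edge lines: `Re (u₀* u₁) = 0` says that `u₀ = 0` or
that `u₁ / u₀` is purely imaginary. -/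
theorem exists_eq_smul_edgeVector {u : Fin 2 → ℂ} (hu : u ≠ 0) (h : sigmaForm u u = 0) :
    ∃ (r : WithTop ℝ) (c : ℂ), c ≠ 0 ∧ u = c • edgeVector r := by
  suffices ∃ (r : WithTop ℝ) (c : ℂ), u = c • edgeVector r by
    obtain ⟨r, c, hc⟩ := this
    refine ⟨r, c, ?_, hc⟩
    rintro rfl
    exact hu (by rw [hc, zero_smul])
  by_cases h0 : u 0 = 0
  · exact ⟨⊤, edgeCondition_iff_exists_smul.1 (edgeCondition_top_iff.2 h0)⟩
  · refine ⟨((u 1 / u 0).im : ℝ), edgeCondition_iff_exists_smul.1 (edgeCondition_coe_iff.2 ?_)⟩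
    have hs : star (u 0) ≠ 0 := star_ne_zero.2 h0
    have hre : (u 1 / u 0).re = 0 := by
      have h1 : u 1 / u 0 + star (u 1 / u 0) = 0 := by
        rw [star_div₀, div_add_div _ _ h0 hs, div_eq_zero_iff]
        left
        rw [sigmaForm] at h
        linear_combination h
      have h2 := congrArg Complex.re h1
      simp only [Complex.add_re, RCLike.star_def, Complex.conj_re, Complex.zero_re] at h2
      linarith
    have he : u 1 / u 0 = Complex.I * ((u 1 / u 0).im : ℂ) := by
      apply Complex.ext <;> simp [hre]
    rw [← he, div_mul_cancel₀ _ h0]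

theorem mem_bcAlpha_iff {α : Fin 4 → ℂ} {x : (Fin 2 → ℂ) × (Fin 2 → ℂ)} :
    x ∈ bcAlpha α ↔ x.2 = (boundaryMatrix α).mulVec x.1 := Iff.rfl

theorem isLagrangian_bcRho (ρplus ρminus : WithTop ℝ) : IsLagrangian (bcRho ρplus ρminus) := by
  rintro ⟨v, w⟩
  constructor
  · rintro ⟨hw, hv⟩ ⟨v', w'⟩ ⟨hw', hv'⟩
    obtain ⟨c, rfl : v' = _⟩ := edgeCondition_iff_exists_smul.1 hv'
    obtain ⟨d, rfl : w' = _⟩ := edgeCondition_iff_exists_smul.1 hw'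
    rw [boundaryForm_eq, sigmaForm_smul_left, sigmaForm_smul_left,
      edgeCondition_iff_sigmaForm.1 hv, edgeCondition_iff_sigmaForm.1 hw]
    simp
  · intro h
    have hz : ∀ r, EdgeCondition r 0 := fun r => by simp [EdgeCondition]
    have he : ∀ r, EdgeCondition r (edgeVector r) := fun r =>
      edgeCondition_iff_exists_smul.2 ⟨1, (one_smul _ _).symm⟩
    have h1 := h (edgeVector ρminus, 0) ⟨hz _, he _⟩
    have h2 := h (0, edgeVector ρplus) ⟨he _, hz _⟩
    simp only [boundaryForm_eq, sigmaForm_zero_left, sub_zero, zero_sub, neg_eq_zero] at h1 h2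
    exact ⟨edgeCondition_iff_sigmaForm.2 h2, edgeCondition_iff_sigmaForm.2 h1⟩

theorem re_mul_star_eq_zero_iff {a b : ℂ} : (a * star b).re = 0 ↔ a * star b + b * star a = 0 := by
  have : a * star b + b * star a = ((2 * (a * star b).re : ℝ) : ℂ) := by
    rw [show b * star a = star (a * star b) by rw [star_mul, star_star], RCLike.star_def,
      Complex.add_conj]
  rw [this]
  norm_cast
  simp

theorem boundaryMatrix_mulVec (α : Fin 4 → ℂ) (v : Fin 2 → ℂ) :
    (boundaryMatrix α).mulVec v = ![α 0 * v 0 + α 1 * v 1, α 2 * v 0 + α 3 * v 1] := by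
  ext i; fin_cases i <;> simp [boundaryMatrix, Matrix.mulVec, dotProduct, Fin.sum_univ_two]

/-- The class of `α` says that `B* σₓ B = σₓ` and `B σₓ B* = σₓ`: the first identity makes the
graph of `B` isotropic, the second inverts `B`. -/
theorem isLagrangian_bcAlpha {α : Fin 4 → ℂ} (hα : ClassAlpha α) : IsLagrangian (bcAlpha α) := by
  obtain ⟨h01, h02, h13, h23, e1, e2⟩ := hα
  rw [re_mul_star_eq_zero_iff] at h01 h02 h13 h23
  have e1' := congrArg star e1
  have e2' := congrArg star e2
  simp only [star_add, star_mul, star_star, star_one] at e1' e2'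
  -- `B* σₓ B = σₓ`.
  have hpres : ∀ u v, sigmaForm ((boundaryMatrix α).mulVec u) ((boundaryMatrix α).mulVec v)
      = sigmaForm u v := by
    intro u v
    simp only [boundaryMatrix_mulVec, sigmaForm, Matrix.cons_val_zero, Matrix.cons_val_one,
      star_add, star_mul]
    linear_combination star (u 0) * v 0 * h02 + star (u 1) * v 1 * h13
      + star (u 1) * v 0 * e2 + star (u 0) * v 1 * e2'
  rintro ⟨v, w⟩
  rw [mem_bcAlpha_iff]
  constructor
  · rintro (rfl : w = (boundaryMatrix α).mulVec v) ⟨v', w'⟩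
      (rfl : w' = (boundaryMatrix α).mulVec v')
    rw [boundaryForm_eq, hpres, sub_self]
  · intro h
    have key : ∀ u, sigmaForm ((boundaryMatrix α).mulVec u)
        (w - (boundaryMatrix α).mulVec v) = 0 := by
      intro u
      have h1 := h (u, (boundaryMatrix α).mulVec u) rfl
      rw [boundaryForm_eq, ← hpres] at h1
      simp only [sigmaForm, Pi.sub_apply] at h1 ⊢
      linear_combination -h1
    set d := w - (boundaryMatrix α).mulVec v with hd
    -- `B u` runs through all of `ℂ²`; two vectors `u` are enough to see that `d = 0`.
    have k0 := key ![1, 0]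
    have k1 := key ![0, 1]
    simp only [boundaryMatrix_mulVec, sigmaForm, Matrix.cons_val_zero, Matrix.cons_val_one,
      mul_one, mul_zero, add_zero, zero_add] at k0 k1
    have hd0 : d 0 = 0 := by
      linear_combination α 1 * k0 + α 0 * k1 - d 0 * e1 - d 1 * h01
    have hd1 : d 1 = 0 := by
      linear_combination α 3 * k0 + α 2 * k1 - d 0 * h23 - d 1 * e1'
    have : d = 0 := by ext i; fin_cases i <;> [exact hd0; exact hd1]
    exact sub_eq_zero.1 this

/-- A subspace of `ℂ²` that is not everything is orthogonal, for `sigmaForm`, to some nonzero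
vector. -/
theorem exists_sigmaForm_eq_zero {P : Submodule ℂ (Fin 2 → ℂ)} (hP : P ≠ ⊤) :
    ∃ u : Fin 2 → ℂ, u ≠ 0 ∧ ∀ y ∈ P, sigmaForm y u = 0 := by
  obtain ⟨f, hf, hle⟩ := Submodule.exists_le_ker_of_lt_top P hP.lt_top
  have hexp : ∀ y : Fin 2 → ℂ, f y = y 0 * f ![1, 0] + y 1 * f ![0, 1] := by
    intro y
    have : y = y 0 • ![1, 0] + y 1 • ![0, 1] := by
      ext i; fin_cases i <;> simp
    conv_lhs => rw [this]
    rw [map_add, map_smul, map_smul, smul_eq_mul, smul_eq_mul]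
  refine ⟨![star (f ![0, 1]), star (f ![1, 0])], fun h => hf ?_, fun y hy => ?_⟩
  · have h0 : star (f ![0, 1]) = 0 := congrFun h 0
    have h1 : star (f ![1, 0]) = 0 := congrFun h 1
    refine LinearMap.ext fun y => ?_
    rw [hexp, star_eq_zero.1 h0, star_eq_zero.1 h1]
    simp
  · have h0 : f y = 0 := hle hy
    have := congrArg star (hexp y)
    rw [h0] at this
    simp only [star_zero, star_add, star_mul] at this
    simp only [sigmaForm, Matrix.cons_val_zero, Matrix.cons_val_one]
    linear_combination -this

variable {C : Submodule ℂ ((Fin 2 → ℂ) × (Fin 2 → ℂ))}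

theorem IsLagrangian.exists_edgeVector_left (hC : IsLagrangian C) {u : Fin 2 → ℂ} (hu : u ≠ 0)
    (h : (u, 0) ∈ C) : ∃ r, (edgeVector r, 0) ∈ C := by
  have h0 := (hC _).1 h _ h
  rw [boundaryForm_eq] at h0
  obtain ⟨r, c, hc, rfl⟩ := exists_eq_smul_edgeVector hu (by simpa using h0)
  refine ⟨r, ?_⟩
  simpa [smul_smul, hc] using C.smul_mem c⁻¹ h

theorem IsLagrangian.exists_edgeVector_right (hC : IsLagrangian C) {u : Fin 2 → ℂ} (hu : u ≠ 0)
    (h : (0, u) ∈ C) : ∃ r, (0, edgeVector r) ∈ C := by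
  have h0 := (hC _).1 h _ h
  rw [boundaryForm_eq] at h0
  obtain ⟨r, c, hc, rfl⟩ := exists_eq_smul_edgeVector hu (by simpa using h0)
  refine ⟨r, ?_⟩
  simpa [smul_smul, hc] using C.smul_mem c⁻¹ h

theorem IsLagrangian.edgeCondition_left (hC : IsLagrangian C) {r : WithTop ℝ}
    (h : (edgeVector r, 0) ∈ C) {x : (Fin 2 → ℂ) × (Fin 2 → ℂ)} (hx : x ∈ C) :
    EdgeCondition r x.1 :=
  edgeCondition_iff_sigmaForm.2 (by simpa [boundaryForm_eq] using (hC _).1 hx _ h)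

theorem IsLagrangian.edgeCondition_right (hC : IsLagrangian C) {r : WithTop ℝ}
    (h : (0, edgeVector r) ∈ C) {x : (Fin 2 → ℂ) × (Fin 2 → ℂ)} (hx : x ∈ C) :
    EdgeCondition r x.2 :=
  edgeCondition_iff_sigmaForm.2 (by simpa [boundaryForm_eq] using (hC _).1 hx _ h)

/-- If `C` contains a vector supported at `-Λ`, it contains one supported at `+Λ`: otherwise every
element of `C` would vanish at `+Λ`, and `C` would contain everything supported there. -/
theorem IsLagrangian.exists_right_of_left (hC : IsLagrangian C) {r : WithTop ℝ}
    (h : (edgeVector r, 0) ∈ C) : ∃ w, w ≠ 0 ∧ (0, w) ∈ C := by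
  by_contra! hno
  have hzero : ∀ y ∈ C, y.2 = 0 := by
    rintro ⟨v, w⟩ hy
    obtain ⟨c, rfl : v = _⟩ := edgeCondition_iff_exists_smul.1 (hC.edgeCondition_left h hy)
    by_contra hw
    exact hno w hw (by simpa using C.sub_mem hy (C.smul_mem c h))
  have hne := edgeVector_ne_zero ⊤
  exact hno _ hne ((hC _).2 fun y hy => by simp [boundaryForm_eq, hzero y hy])

theorem IsLagrangian.exists_left_of_right (hC : IsLagrangian C) {r : WithTop ℝ}
    (h : (0, edgeVector r) ∈ C) : ∃ v, v ≠ 0 ∧ (v, 0) ∈ C := by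
  by_contra! hno
  have hzero : ∀ y ∈ C, y.1 = 0 := by
    rintro ⟨v, w⟩ hy
    obtain ⟨c, rfl : w = _⟩ := edgeCondition_iff_exists_smul.1 (hC.edgeCondition_right h hy)
    by_contra hv
    exact hno v hv (by simpa using C.sub_mem hy (C.smul_mem c h))
  have hne := edgeVector_ne_zero ⊤
  exact hno _ hne ((hC _).2 fun y hy => by simp [boundaryForm_eq, hzero y hy])

theorem IsLagrangian.eq_bcRho (hC : IsLagrangian C) {ρplus ρminus : WithTop ℝ}
    (hl : (edgeVector ρminus, 0) ∈ C) (hr : (0, edgeVector ρplus) ∈ C) :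
    C = bcRho ρplus ρminus := by
  refine le_antisymm
    (fun x hx => ⟨hC.edgeCondition_right hr hx, hC.edgeCondition_left hl hx⟩) ?_
  rintro ⟨v, w⟩ ⟨hw, hv⟩
  obtain ⟨c, rfl : v = _⟩ := edgeCondition_iff_exists_smul.1 hv
  obtain ⟨d, rfl : w = _⟩ := edgeCondition_iff_exists_smul.1 hw
  simpa using C.add_mem (C.smul_mem c hl) (C.smul_mem d hr)

/-- A Lagrangian subspace without nonzero vectors supported at a single boundary point is the graph
of a matrix `B`, and `B* σₓ B = σₓ` is the condition `ClassAlpha`. -/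
theorem IsLagrangian.exists_eq_bcAlpha (hC : IsLagrangian C) (hl : ∀ v, (v, 0) ∈ C → v = 0)
    (hr : ∀ w, (0, w) ∈ C → w = 0) : ∃ α, ClassAlpha α ∧ C = bcAlpha α := by
  -- A vector `u` orthogonal to the projection of `C` to the first factor gives `(u, 0) ∈ C`.
  have htop : C.map (LinearMap.fst ℂ (Fin 2 → ℂ) (Fin 2 → ℂ)) = ⊤ := by
    by_contra hP
    obtain ⟨u, hu, h⟩ := exists_sigmaForm_eq_zero hP
    refine hu (hl u ((hC _).2 fun y hy => ?_))
    simpa [boundaryForm_eq] using h y.1 ⟨y, hy, rfl⟩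
  have hex : ∀ v, ∃ w, (v, w) ∈ C := fun v => by
    obtain ⟨⟨v', w⟩, hy, rfl⟩ := (htop ▸ Submodule.mem_top : v ∈ C.map (LinearMap.fst ℂ _ _))
    exact ⟨w, hy⟩
  obtain ⟨a, ha⟩ := hex ![1, 0]
  obtain ⟨b, hb⟩ := hex ![0, 1]
  have h00 := (hC _).1 ha _ ha
  have h01 := (hC _).1 hb _ ha
  have h10 := (hC _).1 ha _ hb
  have h11 := (hC _).1 hb _ hb
  simp only [boundaryForm_eq, sigmaForm, Matrix.cons_val_zero, Matrix.cons_val_one, star_zero,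
    star_one, mul_zero, mul_one, add_zero, zero_add] at h00 h01 h10 h11
  -- `σₓ B* σₓ` is a left inverse of `B`, hence a right inverse.
  have hinv : (!![star (b 1), star (b 0); star (a 1), star (a 0)] : Matrix (Fin 2) (Fin 2) ℂ)
      * !![a 0, b 0; a 1, b 1] = 1 := by
    rw [Matrix.mul_fin_two, Matrix.one_fin_two,
      show star (b 1) * a 0 + star (b 0) * a 1 = 1 by linear_combination -h10,
      show star (b 1) * b 0 + star (b 0) * b 1 = 0 by linear_combination -h11,
      show star (a 1) * a 0 + star (a 0) * a 1 = 0 by linear_combination -h00,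
      show star (a 1) * b 0 + star (a 0) * b 1 = 1 by linear_combination -h01]
  have hinv' := mul_eq_one_comm.1 hinv
  rw [Matrix.mul_fin_two, Matrix.one_fin_two] at hinv'
  have i00 := congrFun (congrFun hinv' 0) 0
  have i01 := congrFun (congrFun hinv' 0) 1
  have i10 := congrFun (congrFun hinv' 1) 0
  simp only [Matrix.of_apply, Matrix.cons_val_zero, Matrix.cons_val_one] at i00 i01 i10
  refine ⟨![a 0, b 0, a 1, b 1], ⟨?_, ?_, ?_, ?_, ?_, ?_⟩, ?_⟩
  · rw [re_mul_star_eq_zero_iff]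
    change a 0 * star (b 0) + b 0 * star (a 0) = 0
    exact i01
  · rw [re_mul_star_eq_zero_iff]
    change a 0 * star (a 1) + a 1 * star (a 0) = 0
    linear_combination -h00
  · rw [re_mul_star_eq_zero_iff]
    change b 0 * star (b 1) + b 1 * star (b 0) = 0
    linear_combination -h11
  · rw [re_mul_star_eq_zero_iff]
    change a 1 * star (b 1) + b 1 * star (a 1) = 0
    exact i10
  · exact i00
  · change a 0 * star (b 1) + star (b 0) * a 1 = 1
    linear_combination -h10
  · have hgraph : ∀ v, (v, (boundaryMatrix ![a 0, b 0, a 1, b 1]).mulVec v) ∈ C := by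
      intro v
      have := C.add_mem (C.smul_mem (v 0) ha) (C.smul_mem (v 1) hb)
      convert this using 1
      rw [boundaryMatrix_mulVec]
      refine Prod.ext ?_ ?_
      · ext i; fin_cases i <;> simp
      · ext i; fin_cases i <;> simp [mul_comm (v _)]
    refine le_antisymm ?_ ?_
    · rintro ⟨v, w⟩ hvw
      exact sub_eq_zero.1 (hr _ (by simpa using C.sub_mem hvw (hgraph v)))
    · rintro ⟨v, w⟩ (rfl : w = (boundaryMatrix ![a 0, b 0, a 1, b 1]).mulVec v)
      exact hgraph v

theorem isLagrangian_iff :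
    IsLagrangian C ↔ (∃ ρplus ρminus, C = bcRho ρplus ρminus) ∨
      ∃ α, ClassAlpha α ∧ C = bcAlpha α := by
  constructor
  · intro hC
    by_cases hl : ∀ v, (v, 0) ∈ C → v = 0
    · by_cases hr : ∀ w, (0, w) ∈ C → w = 0
      · exact Or.inr (hC.exists_eq_bcAlpha hl hr)
      · push Not at hr
        obtain ⟨w, hw, hw0⟩ := hr
        obtain ⟨r, hr⟩ := hC.exists_edgeVector_right hw0 hw
        obtain ⟨v, hv0, hv⟩ := hC.exists_left_of_right hr
        exact absurd (hl v hv) hv0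
    · push Not at hl
      obtain ⟨v, hv, hv0⟩ := hl
      obtain ⟨r, hr⟩ := hC.exists_edgeVector_left hv0 hv
      obtain ⟨w, hw0, hw⟩ := hC.exists_right_of_left hr
      obtain ⟨s, hs⟩ := hC.exists_edgeVector_right hw0 hw
      exact Or.inl ⟨s, r, hC.eq_bcRho hr hs⟩
  · rintro (⟨ρplus, ρminus, rfl⟩ | ⟨α, hα, rfl⟩)
    · exact isLagrangian_bcRho _ _
    · exact isLagrangian_bcAlpha hα

/-- A separated condition admits a nonzero value at `+Λ` with value zero at `-Λ`, a transmitting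
one does not. -/
theorem bcRho_ne_bcAlpha (ρplus ρminus : WithTop ℝ) (α : Fin 4 → ℂ) :
    bcRho ρplus ρminus ≠ bcAlpha α := by
  intro h
  have h1 : ((0, edgeVector ρplus) : (Fin 2 → ℂ) × (Fin 2 → ℂ)) ∈ bcRho ρplus ρminus :=
    ⟨edgeCondition_iff_exists_smul.2 ⟨1, (one_smul _ _).symm⟩, by simp [EdgeCondition]⟩
  rw [h, mem_bcAlpha_iff, Matrix.mulVec_zero] at h1
  exact edgeVector_ne_zero ρplus h1

end Classification

end DiracJunction

end

theorem mainTheorem2 (m Λ : ℝ) (hm : 0 ≤ m) (hΛ : 0 ≤ Λ)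
    (H : DiracJunction.Spinor Λ →ₗ.[ℂ] DiracJunction.Spinor Λ) :
    (DiracJunction.IsSelfAdjointExtension (DiracJunction.minimalDirac m Λ) H ↔
      (∃ ρplus ρminus : WithTop ℝ, H = DiracJunction.diracRho m Λ ρplus ρminus) ∨
      (∃ α : Fin 4 → ℂ, DiracJunction.ClassAlpha α ∧ H = DiracJunction.diracAlpha m Λ α)) ∧
    ¬ ((∃ ρplus ρminus : WithTop ℝ, H = DiracJunction.diracRho m Λ ρplus ρminus) ∧
      (∃ α : Fin 4 → ℂ, DiracJunction.ClassAlpha α ∧ H = DiracJunction.diracAlpha m Λ α)) := by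
  refine ⟨?_, ?_⟩
  · rw [DiracJunction.isSelfAdjointExtension_iff hΛ m]
    constructor
    · rintro ⟨C, hC, rfl⟩
      rcases DiracJunction.isLagrangian_iff.1 hC with ⟨ρplus, ρminus, rfl⟩ | ⟨α, hα, rfl⟩
      · exact Or.inl ⟨ρplus, ρminus, rfl⟩
      · exact Or.inr ⟨α, hα, rfl⟩
    · rintro (⟨ρplus, ρminus, rfl⟩ | ⟨α, hα, rfl⟩)
      · exact ⟨_, DiracJunction.isLagrangian_bcRho ρplus ρminus, rfl⟩
      · exact ⟨_, DiracJunction.isLagrangian_bcAlpha hα, rfl⟩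
  · rintro ⟨⟨ρplus, ρminus, h⟩, α, -, h'⟩
    exact DiracJunction.bcRho_ne_bcAlpha ρplus ρminus α
      (DiracJunction.diracBC_injective hΛ m (h.symm.trans h'))
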